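/- Let $\sigma$ be a substitution over a finite alphabet $\mathcal A$ (every letter has a non-empty image, and $|\sigma^k(a)|\to\infty$ for at least one letter $a$), with incidence matrix $M_\sigma$, $(M_\sigma)_{a,b}=|\sigma(b)|_a$. Assume that $\sigma$ is an irreducible Pisot substitution: the characteristic polynomial of $M_\sigma$ is irreducible over $\mathbb Q$, and the dominant eigenvalue $\alpha$ of $M_\sigma$ is a Pisot number. Let $K=\mathbb Q(\alpha)$, let $\mathfrak p_1$ be the infinite place of $K$ given by the inclusion $K\subset\mathbb R$, and let $$K_\sigma=\prod_{\mathfrak p\mid\infty,\ \mathfrak p\neq\mathfrak p_1}K_{\mathfrak p}\times\prod_{\mathfrak p\mid(\alpha)}K_{\mathfrak p},$$ where $K_{\mathfrak p}$ is the completion of $K$ at $\mathfrak p$. Let $\Phi':K\to K_\sigma$ be the diagonal embedding, let $K$ act on $K_\sigma$ by $\xi\cdot\mathbf z=\Phi'(\xi)\mathbf z$, and let $\mu$ be a Haar measure on $K_\sigma$. Let $\mathbf v=(v_a)_{a\in\mathcal A}\in K^{\mathcal A}$ be a left eigenvector of $M_\sigma$ for $\alpha$, and put $\delta(p)=\sum_{a\in\mathcal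 A}|p|_a\,v_a$ for each finite word $p$. The prefix automaton has the vertex set $\mathcal A$ and an edge $b\xrightarrow{p}a$ whenever $\sigma(b)=pas$ for some finite words $p,s$. For $k\ge 0$ let $\mathbb Z_{\sigma,a}^{(k)}\subset\mathbb R$ be the set of all sums $\sum_{i=0}^{k-1}\delta(p_i)\alpha^i$ over the walks $a_k\xrightarrow{p_{k-1}}\cdots\xrightarrow{p_1}a_1\xrightarrow{p_0}a$ in the prefix automaton. Let $\mathbb Z_{\sigma,a}\subset K$ be the topological (Kuratowski) limit in $\mathbb R$ of these sets as $k\to\infty$, and let the subtiles be $\mathcal R_\sigma(a)=\overline{\Phi'(\mathbb Z_{\sigma,a})}$. Let $T_{\rm ext}^{-1}(\gamma,a)=\{(\alpha^{-1}(\gamma+\Phi'(\delta(p))),b): b\xrightarrow{p}a\}$ for $(\gamma,a)\in K_\sigma\times\mathcal A$. Then the topological limits $\mathbb Z_{\sigma,a}$ exist, and the following hold. (i) The family $(\mathcal R_\sigma(a))_{a\in\mathcal A}$ is the solution of a graph-directed iterated function system: it consists of non-empty compact sets, for every $a\in\mathcal A$ $$\mathcal R_\sigma(a)=\bigcup_{(\gamma,b)\in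 T_{\rm ext}^{-1}(\mathbf 0,a)}\alpha(\mathcal R_\sigma(b)+\gamma)=\bigcup_{b\xrightarrow{p}a}\bigl(\alpha\mathcal R_\sigma(b)+\Phi'(\delta(p))\bigr),$$ and it is the only family of non-empty compact subsets of $K_\sigma$ that satisfies the equation between the first and the last term for all $a\in\mathcal A$. The union is measure disjoint: the sets that belong to two different edges $b\xrightarrow{p}a$ and $b'\xrightarrow{p'}a$ intersect in a set of $\mu$-measure zero. (ii) Each subtile $\mathcal R_\sigma(a)$ is the closure of its interior. (iii) The boundary of each subtile $\mathcal R_\sigma(a)$ has $\mu$-measure zero. -/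

import Mathlib

open Filter Topology MeasureTheory NumberField IsDedekindDomain

noncomputable section

namespace PisotSubst

/-- A substitution over the alphabet `A`, given by the images of the letters: these are non-empty
words, and the length of the iterates of at least one letter tends to infinity. -/
structure Substitution (A : Type*) where
  img : A → List A
  img_ne_nil : ∀ a, img a ≠ []
  exists_growing :
    ∃ a, Tendsto (fun k : ℕ => ((fun w : List A => w.flatMap img)^[k] [a]).length) atTop atTop

/-- A Pisot number: a real algebraic integer `β > 1` all of whose other conjugates have modulus
less than `1`. -/
def IsPisot (β : ℝ) : Prop :=
  IsIntegral ℤ β ∧ 1 < β ∧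
    ∀ z : ℂ, Polynomial.aeval z (minpoly ℚ β) = 0 → z ≠ (β : ℂ) → ‖z‖ < 1

/-- `β` is an eigenvalue of the rational matrix `M`, of maximal modulus. -/
def IsDominantEigenvalue {A : Type*} [Fintype A] [DecidableEq A] (M : Matrix A A ℚ) (β : ℝ) :
    Prop :=
  Polynomial.aeval β M.charpoly = 0 ∧
    ∀ z : ℂ, Polynomial.aeval z M.charpoly = 0 → ‖z‖ ≤ β

/-- Topological (Kuratowski) lower limit of a sequence of sets. -/
def lowerLimit {X : Type*} [TopologicalSpace X] (S : ℕ → Set X) : Set X :=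
  {x | ∀ U ∈ 𝓝 x, ∀ᶠ k in atTop, (S k ∩ U).Nonempty}

/-- Topological (Kuratowski) upper limit of a sequence of sets. -/
def upperLimit {X : Type*} [TopologicalSpace X] (S : ℕ → Set X) : Set X :=
  {x | ∀ U ∈ 𝓝 x, ∃ᶠ k in atTop, (S k ∩ U).Nonempty}

/-- `L` is the topological limit of the sequence of sets `S`. -/
def IsTopologicalLimit {X : Type*} [TopologicalSpace X] (S : ℕ → Set X) (L : Set X) : Prop :=
  lowerLimit S = L ∧ upperLimit S = L

namespace Substitution

variable {A : Type*} (σ : Substitution A)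

/-- The edge `a --p--> b` of the prefix automaton: `σ(a) = p b s` for some word `s`. -/
def Edge (a : A) (p : List A) (b : A) : Prop :=
  ∃ s : List A, σ.img a = p ++ b :: s

/-- The incidence matrix: the entry `(a, b)` is the number of occurrences of `a` in `σ(b)`. -/
def incidence [DecidableEq A] : Matrix A A ℕ :=
  Matrix.of fun a b => (σ.img b).count a

/-- `σ` is an irreducible Pisot substitution with associated Pisot root `β`. -/
def IsIrreduciblePisot [Fintype A] [DecidableEq A] (β : ℝ) : Prop :=
  Irreducible (σ.incidence.map (Nat.cast : ℕ → ℚ)).charpoly ∧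
    IsDominantEigenvalue (σ.incidence.map (Nat.cast : ℕ → ℚ)) β ∧ IsPisot β

/-- `v` is a left eigenvector, with entries in `K`, of the incidence matrix for the
eigenvalue `α`. -/
def IsLeftEigenvector [Fintype A] [DecidableEq A] {K : Type*} [Field K] (α : K) (v : A → K) :
    Prop :=
  v ≠ 0 ∧ Matrix.vecMul v (σ.incidence.map (Nat.cast : ℕ → K)) = α • v

end Substitution

/-- The digit map `δ(p) = ⟨P(p), v⟩`, where `P` is the abelianisation map. -/
def digit {A : Type*} [Fintype A] [DecidableEq A] {K : Type*} [Field K] (v : A → K)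
    (p : List A) : K :=
  ∑ a, (p.count a : K) * v a

section Tiles

variable {A : Type*} [Fintype A] [DecidableEq A] (σ : Substitution A)
  {K : Type*} [Field K]

/-- The set of numbers `∑_{i<k} δ(p i) α^i`, over all walks
`c k --p (k-1)--> ⋯ --p 1--> c 1 --p 0--> c 0 = a` of length `k` in the prefix automaton that end
at `a`; the numbers are elements of `K`, seen in `ℝ` through the embedding `ι`. -/
def approxIntegers (ι : K →+* ℝ) (α : K) (v : A → K) (a : A) (k : ℕ) : Set ℝ :=
  {x | ∃ (c : ℕ → A) (p : ℕ → List A), c 0 = a ∧ (∀ i < k, σ.Edge (c (i + 1)) (p i) (c i)) ∧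
    x = ι (∑ i ∈ Finset.range k, digit v (p i) * α ^ i)}

/-- The `(σ, a)`-integers: the topological limit of the sets `approxIntegers` in `ℝ` (defined as
the lower limit; that the topological limit exists is a separate claim). -/
def sigmaIntegers (ι : K →+* ℝ) (α : K) (v : A → K) (a : A) : Set ℝ :=
  lowerLimit (approxIntegers σ ι α v a)

variable [NumberField K]

/-- The infinite place of `K` given by a real embedding `ι`. -/
def mainPlace (ι : K →+* ℝ) : InfinitePlace K :=
  InfinitePlace.mk (Complex.ofRealHom.comp ι)

/-- The representation space: the product of the completions of `K` at the infinite places other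
than the one given by `ι`, and at the finite places that divide the principal ideal `(α)`. -/
abbrev RepSpace (ι : K →+* ℝ) (α : K) : Type _ :=
  ((w : {w : InfinitePlace K // w ≠ mainPlace ι}) → w.1.Completion) ×
    ((𝔭 : {𝔭 : HeightOneSpectrum (𝓞 K) // 𝔭.valuation K α < 1}) → 𝔭.1.adicCompletion K)

/-- The diagonal embedding `Φ'` of `K` into the representation space. -/
def diag (ι : K →+* ℝ) (α : K) : K →+* RepSpace ι α :=
  algebraMap K (RepSpace ι α)

/-- The (Dumont-Thomas) subtile: the closure of the image under `Φ'` of the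
`(σ, a)`-integers. -/
def subtile (ι : K →+* ℝ) (α : K) (v : A → K) (a : A) : Set (RepSpace ι α) :=
  closure (diag ι α '' {x : K | ι x ∈ sigmaIntegers σ ι α v a})

/-- The map `(γ, a) ↦ {(α⁻¹ (γ + Φ'(δ(p))), b) : b --p--> a}`. -/
def preimageExt (ι : K →+* ℝ) (α : K) (v : A → K) (q : RepSpace ι α × A) :
    Set (RepSpace ι α × A) :=
  {r | ∃ p : List A, σ.Edge r.2 p q.2 ∧ r.1 = diag ι α α⁻¹ * (q.1 + diag ι α (digit v p))}

/-- The set `α S + Φ'(δ(p))`. -/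
def piece (ι : K →+* ℝ) (α : K) (v : A → K) (S : Set (RepSpace ι α)) (p : List A) :
    Set (RepSpace ι α) :=
  (fun z => diag ι α α * z + diag ι α (digit v p)) '' S

/-- The family `S` satisfies the graph-directed set equation
`S a = ⋃_{b --p--> a} (α S b + Φ'(δ(p)))`. -/
def SatisfiesGIFS (ι : K →+* ℝ) (α : K) (v : A → K) (S : A → Set (RepSpace ι α)) : Prop :=
  ∀ a, S a = ⋃ (b : A) (p : List A) (_ : σ.Edge b p a), piece ι α v (S b) p

end Tiles

end PisotSubst

end

/-!
Write `Φ` for the diagonal embedding of `K` into the representation space. The proof uses three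
facts about it. Multiplication by `α` is a contraction of the representation space
(`tendsto_diag_pow`): the only archimedean place where `α` is large has been left out, and `α` is
small at the primes that divide it. The lattice `L` generated over `ℤ` by the entries of `v`
satisfies `α L ⊆ L`, and `L[α⁻¹]` is discrete in the product of `ℝ` with the representation space
(`finite_setOf_mem_isCompact`), because up to a common denominator and a power of `α` its elements
in a compact set are algebraic integers with bounded conjugates. Finally, the closure of `Φ(L)`
has interior points (`interior_closure_lattice_nonempty`).

Perron–Frobenius theory is not needed as such. The entry `(a, b)` of `M ^ k` is the trace of
`w a * α ^ k * v b`, where `w` is the basis of `K` dual to `v`. As `α` dominates its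
conjugates, it is asymptotic to `α ^ k` times the non-zero number `w a * v b`; so all
these numbers are positive, the entries of `v` have one sign, and any two letters are joined by a
walk (`perron_frobenius`).

With a real number `c` for which all `c v a` are positive, `c t ≥ 0` holds for every sum `t` of a
walk, and a walk whose sum lies in a bounded part of the line has only boundedly many non-empty
labels. Hence the `(σ, a)`-integers are the sums of the finite walks that begin at a letter that is
periodic under the map to the first letter of the image, and this set is both the lower and the
upper limit of the approximations (`limits_approxIntegers`). It satisfies the graph-directed set
equation, which passes to closures; the subtiles are compact since all sums of walks lie in a
compact set after applying `Φ` (`exists_isCompact_walk`), and the solution is unique by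
contraction.

A greedy expansion (`exists_walk_greedy`) shows that every non-negative lattice point is the sum
of a walk from a periodic letter plus a lattice point that is bounded in `ℝ`. In a compact set
there are only finitely many choices for the latter, so finitely many translates of subtiles cover
a set with interior points, and one of the subtiles has an interior point
(`exists_interior_tile_nonempty`). As all letters are joined by walks, each subtile has one, and
by self-similarity each is the closure of its interior.

Let multiplication by `α` scale the Haar measure by `l`. The greedy expansion also provides about
`α ^ k` walks of length `k` whose sums are separated in `ℝ`, and discreteness turns this into a
packing of a compact set by translates of `α ^ k U`, which gives `α * l ≤ 1`
(`scaling_factor_le`). Since `v` is a left eigenvector for `α`, the set equation then leaves no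
room for an overlap of positive measure (`measure_edgePiece_inter`). For the boundary, some piece
of a subtile is a copy of the same subtile inside its interior. The boundary of a piece meets the
interior of the subtile only in points of other pieces, hence in a null set, so the boundary of
the copy is null (`measure_frontier_tile`).
-/

open scoped Pointwise

noncomputable section

namespace PisotSubst

/-! ### Walks in the prefix automaton -/

section Walks

variable {A : Type*} [Fintype A] [DecidableEq A] {σ : Substitution A} {K : Type*} [Field K]
  {α : K} {v : A → K}

theorem digit_eq_sum_map (v : A → K) (p : List A) : digit v p = (p.map v).sum := by
  rw [digit, Finset.sum_list_map_count, ← Finset.sum_subset (Finset.subset_univ p.toFinset)]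
  · simp [nsmul_eq_mul]
  · intro a _ ha
    rw [List.mem_toFinset] at ha
    simp [List.count_eq_zero_of_not_mem ha]

@[simp] theorem digit_nil (v : A → K) : digit v ([] : List A) = 0 := by
  simp [digit_eq_sum_map]

theorem digit_cons (v : A → K) (a : A) (p : List A) : digit v (a :: p) = v a + digit v p := by
  simp [digit_eq_sum_map]

omit [Fintype A] [DecidableEq A] in
/-- The edges that leave `b` correspond to the positions in the word `σ(b)`. -/
theorem Substitution.edge_iff_exists_fin {b a : A} {p : List A} :
    σ.Edge b p a ↔
      ∃ i : Fin (σ.img b).length, p = (σ.img b).take i ∧ (σ.img b).get i = a := by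
  constructor
  · rintro ⟨s, hs⟩
    refine ⟨⟨p.length, by simp [hs]⟩, ?_, ?_⟩ <;> simp [hs]
  · rintro ⟨i, rfl, rfl⟩
    refine ⟨(σ.img b).drop (i + 1), ?_⟩
    simp

variable (σ) in
/-- The first letter of the word `σ(a)`. -/
def Substitution.first (a : A) : A := (σ.img a).head (σ.img_ne_nil a)

omit [Fintype A] [DecidableEq A] in
theorem Substitution.edge_nil_iff {a b : A} : σ.Edge b [] a ↔ σ.first b = a := by
  constructor
  · rintro ⟨s, hs⟩
    simp [Substitution.first, hs]
  · rintro rfl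
    exact ⟨(σ.img b).tail, by simp [Substitution.first]⟩

variable (σ α v) in
/-- `Walk σ α v k b a t` says that `t = ∑_{i<k} δ(p i) α^i` for some walk
`b = c k --p (k-1)--> ⋯ --p 0--> c 0 = a` of length `k` in the prefix automaton. The walk is built
from its first vertex `b` backwards: a new edge is attached at the end `a`. -/
inductive Walk : ℕ → A → A → K → Prop
  | nil (a : A) : Walk 0 a a 0
  | cons {k : ℕ} {b c a : A} {p : List A} {t : K} (he : σ.Edge c p a) (hw : Walk k b c t) :
      Walk (k + 1) b a (digit v p + α * t)

namespace Walk

theorem zero_iff {b a : A} {t : K} : Walk σ α v 0 b a t ↔ b = a ∧ t = 0 := by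
  constructor
  · rintro ⟨⟩
    exact ⟨rfl, rfl⟩
  · rintro ⟨rfl, rfl⟩
    exact .nil _

theorem succ_iff {k : ℕ} {b a : A} {t : K} : Walk σ α v (k + 1) b a t ↔
    ∃ c p s, σ.Edge c p a ∧ Walk σ α v k b c s ∧ t = digit v p + α * s := by
  constructor
  · rintro (_ | ⟨he, hw⟩)
    exact ⟨_, _, _, he, hw, rfl⟩
  · rintro ⟨c, p, s, he, hw, rfl⟩
    exact .cons he hw

theorem append {j k : ℕ} {b c a : A} {t s : K} (h₁ : Walk σ α v j c a t)
    (h₂ : Walk σ α v k b c s) : Walk σ α v (j + k) b a (t + α ^ j * s) := by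
  induction h₁ with
  | nil a => simpa using h₂
  | @cons j c d a p t he hw ih =>
    have := Walk.cons he (ih h₂)
    rw [show j + 1 + k = j + k + 1 by ring]
    convert this using 1
    ring

/-- The last `j` edges of a walk carry the lowest powers of `α`. -/
theorem split {j k : ℕ} {b a : A} {t : K} (h : Walk σ α v (j + k) b a t) :
    ∃ c s r, Walk σ α v j c a s ∧ Walk σ α v k b c r ∧ t = s + α ^ j * r := by
  induction j generalizing a t with
  | zero =>
    rw [zero_add] at h
    exact ⟨a, 0, t, .nil a, h, by simp⟩
  | succ j ih =>
    rw [show j + 1 + k = j + k + 1 by ring, succ_iff] at h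
    obtain ⟨d, p, s, he, hw, rfl⟩ := h
    obtain ⟨c, s', r, h₁, h₂, rfl⟩ := ih hw
    exact ⟨c, _, r, .cons he h₁, h₂, by ring⟩

theorem single {b a : A} {p : List A} (he : σ.Edge b p a) : Walk σ α v 1 b a (digit v p) := by
  simpa using Walk.cons (α := α) (v := v) he (.nil b)

/-- Edges with the empty label lead to the first letters of the images. -/
theorem iterate_first (k : ℕ) (b : A) : Walk σ α v k b (σ.first^[k] b) 0 := by
  induction k with
  | zero => exact .nil b
  | succ k ih =>
    rw [Function.iterate_succ_apply']
    simpa using Walk.cons (Substitution.edge_nil_iff.2 rfl) ih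

end Walk

variable (σ) in
omit [DecidableEq A] in
theorem Substitution.finite_edges : {e : A × List A × A | σ.Edge e.1 e.2.1 e.2.2}.Finite := by
  refine (Set.finite_range fun x : (Σ b : A, Fin (σ.img b).length) =>
    (x.1, (σ.img x.1).take x.2, (σ.img x.1).get x.2)).subset ?_
  rintro ⟨b, p, a⟩ (h : σ.Edge b p a)
  obtain ⟨i, rfl, rfl⟩ := Substitution.edge_iff_exists_fin.1 h
  exact ⟨⟨b, i⟩, rfl⟩

variable (σ α v) in
theorem finite_walkSums (k : ℕ) : {t | ∃ b a, Walk σ α v k b a t}.Finite := by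
  induction k with
  | zero =>
    refine (Set.finite_singleton (0 : K)).subset ?_
    rintro t ⟨b, a, h⟩
    exact (Walk.zero_iff.1 h).2
  | succ k ih =>
    refine ((σ.finite_edges.prod ih).image fun x => digit v x.1.2.1 + α * x.2).subset ?_
    rintro t ⟨b, a, h⟩
    obtain ⟨c, p, s, he, hw, rfl⟩ := Walk.succ_iff.1 h
    exact ⟨((c, p, a), s), ⟨he, b, c, hw⟩, rfl⟩

/-- The approximations are the real images of the sums of walks of a given length. -/
theorem mem_approxIntegers_iff {ι : K →+* ℝ} {a : A} {k : ℕ} {x : ℝ} :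
    x ∈ approxIntegers σ ι α v a k ↔ ∃ b t, Walk σ α v k b a t ∧ ι t = x := by
  constructor
  · rintro ⟨c, p, rfl, he, rfl⟩
    refine ⟨c k, _, ?_, rfl⟩
    induction k with
    | zero => simpa using Walk.nil (c 0)
    | succ k ih =>
      have h := (ih fun i hi => he i (by omega)).append (Walk.single (he k (by omega)))
      rw [Finset.sum_range_succ, mul_comm (digit v (p k))]
      exact h
  · rintro ⟨b, t, h, rfl⟩
    induction h with
    | nil a => exact ⟨fun _ => a, fun _ => [], rfl, by simp, by simp⟩
    | @cons k b c a p t he hw ih =>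
      obtain ⟨c', p', rfl, he', ht⟩ := ih
      refine ⟨fun i => Nat.casesOn i a c', fun i => Nat.casesOn i p p', rfl, ?_, ?_⟩
      · rintro (_ | i) hi
        · exact he
        · exact he' i (by omega)
      · rw [Finset.sum_range_succ']
        rw [ι.injective ht, Finset.mul_sum, add_comm]
        simp [pow_succ, mul_assoc, mul_comm α]

/-! ### The integers as finite sums over eventually empty walks -/

variable (σ α v) in
/-- The elements of `K` whose images under the real embedding form the `(σ, a)`-integers: sums over
finite walks that end at `a` and start at a letter that is periodic under the first letter map.
Such a walk extends backwards indefinitely by edges with the empty label. -/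
def integerSet (a : A) : Set K :=
  {t | ∃ e ∈ Function.periodicPts σ.first, ∃ k, Walk σ α v k e a t}

omit [Fintype A] [DecidableEq A] in
/-- The first letter map permutes its periodic points, so that periodic letters have walks with
empty labels of any length behind them. -/
theorem Substitution.exists_periodic_iterate_eq {e : A} (he : e ∈ Function.periodicPts σ.first)
    (k : ℕ) : ∃ e' ∈ Function.periodicPts σ.first, σ.first^[k] e' = e :=
  ((Function.bijOn_periodicPts (f := σ.first)).iterate k).surjOn he

omit [DecidableEq A] in
theorem Substitution.iterate_first_mem_periodicPts {k : ℕ} (hk : Fintype.card A ≤ k) (b : A) :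
    σ.first^[k] b ∈ Function.periodicPts σ.first := by
  obtain ⟨i, j, hij, h⟩ := Fintype.exists_ne_map_eq_of_card_lt
    (fun i : Fin (Fintype.card A + 1) => σ.first^[(i : ℕ)] b) (by simp)
  have key : ∀ i j : ℕ, i < j → i ≤ k → σ.first^[i] b = σ.first^[j] b →
      σ.first^[k] b ∈ Function.periodicPts σ.first := by
    intro i j hlt hik h
    have : Function.IsPeriodicPt σ.first (j - i) (σ.first^[i] b) := by
      rw [Function.IsPeriodicPt, Function.IsFixedPt, ← Function.iterate_add_apply,
        Nat.sub_add_cancel hlt.le, h]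
    have h2 := this.apply_iterate (k - i)
    rw [← Function.iterate_add_apply, Nat.sub_add_cancel hik] at h2
    exact Function.mk_mem_periodicPts (by omega) h2
  rcases lt_or_gt_of_ne (fun h => hij (Fin.ext h) : (i : ℕ) ≠ j) with hlt | hlt
  · exact key i j hlt (by omega) h
  · exact key j i hlt (by omega) h.symm

/-- The `(σ, a)`-integers satisfy the graph-directed set equation. -/
theorem integerSet_eq_iUnion (a : A) : integerSet σ α v a =
    ⋃ (b : A) (p : List A) (_ : σ.Edge b p a),
      (fun t => digit v p + α * t) '' integerSet σ α v b := by
  ext t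
  simp only [Set.mem_iUnion, Set.mem_image, exists_prop]
  constructor
  · rintro ⟨e, he, k, hw⟩
    cases k with
    | zero =>
      obtain ⟨rfl, rfl⟩ := Walk.zero_iff.1 hw
      obtain ⟨e', he', h⟩ := Substitution.exists_periodic_iterate_eq he 1
      exact ⟨e', [], Substitution.edge_nil_iff.2 h, 0, ⟨e', he', 0, .nil e'⟩, by simp⟩
    | succ k =>
      obtain ⟨c, p, s, hc, hs, rfl⟩ := Walk.succ_iff.1 hw
      exact ⟨c, p, hc, s, ⟨e, he, k, hs⟩, rfl⟩
  · rintro ⟨b, p, hb, s, ⟨e, he, k, hw⟩, rfl⟩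
    exact ⟨e, he, k + 1, .cons hb hw⟩

end Walks

/-! ### Walks on the real line -/

section Positive

variable {A : Type*} [Fintype A] [DecidableEq A] {σ : Substitution A} {K : Type*} [Field K]
  {α : K} {v : A → K} {ι : K →+* ℝ} {c : ℝ}

theorem digit_nonneg (hc : ∀ a, 0 < c * ι (v a)) (p : List A) : 0 ≤ c * ι (digit v p) := by
  induction p with
  | nil => simp
  | cons a p ih =>
    rw [digit_cons, map_add, mul_add]
    exact add_nonneg (hc a).le ih

theorem le_digit {d : ℝ} (hc : ∀ a, 0 < c * ι (v a)) (hd : ∀ a, d ≤ c * ι (v a)) {p : List A}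
    (hp : p ≠ []) : d ≤ c * ι (digit v p) := by
  cases p with
  | nil => exact absurd rfl hp
  | cons a p =>
    rw [digit_cons, map_add, mul_add]
    linarith [hd a, digit_nonneg hc p]

theorem Walk.nonneg (hc : ∀ a, 0 < c * ι (v a)) (hα : 1 < ι α) {k : ℕ} {b a : A} {t : K}
    (h : Walk σ α v k b a t) : 0 ≤ c * ι t := by
  induction h with
  | nil a => simp
  | @cons k b d a p t he hw ih =>
    have : c * ι (digit v p + α * t) = c * ι (digit v p) + ι α * (c * ι t) := by
      rw [map_add, map_mul]; ring
    rw [this]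
    have := digit_nonneg hc p
    positivity

/-- A walk whose sum is smaller than every single letter has only empty labels. -/
theorem Walk.eq_iterate_first_of_lt {d : ℝ} (hc : ∀ a, 0 < c * ι (v a))
    (hd : ∀ a, d ≤ c * ι (v a)) (hα : 1 < ι α) {k : ℕ} {b a : A} {t : K}
    (h : Walk σ α v k b a t) (ht : c * ι t < d) : t = 0 ∧ a = σ.first^[k] b := by
  induction h with
  | nil a => simp
  | @cons k b e a p t he hw ih =>
    have hsum : c * ι (digit v p + α * t) = c * ι (digit v p) + ι α * (c * ι t) := by
      rw [map_add, map_mul]; ring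
    rw [hsum] at ht
    have h1 := digit_nonneg hc p
    have h2 := hw.nonneg hc hα
    have hp : p = [] := by
      by_contra hp
      have := le_digit hc hd hp
      nlinarith
    subst hp
    obtain ⟨rfl, rfl⟩ := ih (by nlinarith)
    refine ⟨by simp, ?_⟩
    rw [Function.iterate_succ_apply']
    exact (Substitution.edge_nil_iff.1 he).symm

/-- In a bounded part of the real line only boundedly many labels of a walk are non-empty, and
these are preceded by a letter that is periodic under the first letter map. -/
theorem exists_walk_of_abs_le [Nonempty A] (hc : ∀ a, 0 < c * ι (v a)) (hα : 1 < ι α) (R : ℝ) :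
    ∃ m : ℕ, ∀ k, m + Fintype.card A ≤ k → ∀ b a t, Walk σ α v k b a t → |ι t| ≤ R →
      ∃ e ∈ Function.periodicPts σ.first, Walk σ α v m e a t := by
  obtain ⟨a₀, ha₀⟩ := Finite.exists_min fun a => c * ι (v a)
  have hd := hc a₀
  obtain ⟨m, hm⟩ := pow_unbounded_of_one_lt (|c| * R / (c * ι (v a₀))) hα
  refine ⟨m, fun k hk b a t h ht => ?_⟩
  obtain ⟨l, rfl⟩ := Nat.exists_eq_add_of_le (show m ≤ k by omega)
  obtain ⟨e, s, r, h₁, h₂, rfl⟩ := h.split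
  rw [div_lt_iff₀ hd] at hm
  have hpow : 0 < ι α ^ m := by positivity
  have hlt : c * ι r < c * ι (v a₀) := by
    have h1 : c * ι (s + α ^ m * r) ≤ |c| * R :=
      (le_abs_self _).trans (by rw [abs_mul]; gcongr)
    have h2 : c * ι (s + α ^ m * r) = c * ι s + ι α ^ m * (c * ι r) := by
      rw [map_add, map_mul, map_pow]; ring
    have h3 := h₁.nonneg hc hα
    rw [h2] at h1
    exact lt_of_mul_lt_mul_left (by linarith) hpow.le
  obtain ⟨rfl, rfl⟩ := h₂.eq_iterate_first_of_lt hc ha₀ hα hlt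
  exact ⟨_, Substitution.iterate_first_mem_periodicPts (k := l) (by omega) b, by simpa using h₁⟩

/-- The real `(σ, a)`-integers are both the lower and the upper limit of the approximations. -/
theorem limits_approxIntegers [Nonempty A] (hc : ∀ a, 0 < c * ι (v a)) (hα : 1 < ι α) (a : A) :
    lowerLimit (approxIntegers σ ι α v a) = ι '' integerSet σ α v a ∧
      upperLimit (approxIntegers σ ι α v a) = ι '' integerSet σ α v a := by
  have h1 : ι '' integerSet σ α v a ⊆ lowerLimit (approxIntegers σ ι α v a) := by
    rintro _ ⟨t, ⟨e, he, k, hw⟩, rfl⟩ U hU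
    filter_upwards [eventually_ge_atTop k] with k' hk'
    obtain ⟨l, rfl⟩ := Nat.exists_eq_add_of_le hk'
    obtain ⟨e', -, rfl⟩ := Substitution.exists_periodic_iterate_eq he l
    refine ⟨ι t, mem_approxIntegers_iff.2 ⟨e', t, ?_, rfl⟩, mem_of_mem_nhds hU⟩
    simpa using hw.append (Walk.iterate_first l e')
  have h2 : lowerLimit (approxIntegers σ ι α v a) ⊆ upperLimit (approxIntegers σ ι α v a) :=
    fun x hx U hU => (hx U hU).frequently
  have h3 : upperLimit (approxIntegers σ ι α v a) ⊆ ι '' integerSet σ α v a := by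
    intro x hx
    obtain ⟨m, hm⟩ := exists_walk_of_abs_le (σ := σ) (v := v) hc hα (|x| + 1)
    set F : Set ℝ := ι '' {t | ∃ e ∈ Function.periodicPts σ.first, Walk σ α v m e a t}
    have hF : F.Finite :=
      ((finite_walkSums σ α v m).subset
        (by rintro t ⟨e, -, h⟩; exact ⟨e, a, h⟩)).image _
    by_contra hxn
    have hxF : x ∉ F := by
      rintro ⟨t, ⟨e, he, h⟩, rfl⟩
      exact hxn ⟨t, ⟨e, he, m, h⟩, rfl⟩
    have hU : Fᶜ ∩ Metric.ball x 1 ∈ 𝓝 x :=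
      inter_mem (hF.isClosed.isOpen_compl.mem_nhds hxF) (Metric.ball_mem_nhds x one_pos)
    obtain ⟨k, ⟨y, hy, hyF, hyx⟩, hk⟩ :=
      ((hx _ hU).and_eventually (eventually_ge_atTop (m + Fintype.card A))).exists
    obtain ⟨b, t, hw, rfl⟩ := mem_approxIntegers_iff.1 hy
    obtain ⟨e, he, h⟩ := hm k hk b a t hw (by
      rw [Metric.mem_ball, Real.dist_eq] at hyx
      have := abs_sub_abs_le_abs_sub (ι t) x
      linarith)
    exact hyF ⟨t, ⟨e, he, h⟩, rfl⟩
  exact ⟨(h2.trans h3).antisymm h1, h3.antisymm (h1.trans h2)⟩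

/-- Greedy expansion: if the image of a letter `b` has `α` times the length of `b`, then every point
of the interval of length `α^k v_b` lies in an interval of length `v_a` that begins at the sum of a
walk of length `k` from `b` to `a`. -/
theorem exists_walk_greedy
    (hv : ∀ b, digit v (σ.img b) = α * v b) (k : ℕ) (b : A) {x : ℝ} (hx₀ : 0 ≤ x)
    (hx : x < ι α ^ k * (c * ι (v b))) :
    ∃ a t, Walk σ α v k b a t ∧ c * ι t ≤ x ∧ x < c * ι t + c * ι (v a) := by
  induction k generalizing b x with
  | zero => exact ⟨b, 0, .nil b, by simpa using hx₀, by simpa using hx⟩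
  | succ k ih =>
    -- locate `x` in the subdivision of the interval by the letters of `σ(b)`
    have key : ∀ w : List A, ∀ y : ℝ, 0 ≤ y → y < ι α ^ k * (c * ι (digit v w)) →
        ∃ p a s, w = p ++ a :: s ∧ ι α ^ k * (c * ι (digit v p)) ≤ y ∧
          y < ι α ^ k * (c * ι (digit v p)) + ι α ^ k * (c * ι (v a)) := by
      intro w
      induction w with
      | nil => intro y h0 h1; simp at h1; linarith
      | cons a w ihw =>
        intro y h0 h1
        rw [digit_cons, map_add, mul_add, mul_add] at h1
        by_cases hy : y < ι α ^ k * (c * ι (v a))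
        · exact ⟨[], a, w, rfl, by simpa using h0, by simpa using hy⟩
        · obtain ⟨p, d, s, rfl, h2, h3⟩ := ihw (y - ι α ^ k * (c * ι (v a))) (by linarith)
            (by linarith)
          refine ⟨a :: p, d, s, rfl, ?_, ?_⟩ <;>
          · rw [digit_cons, map_add, mul_add, mul_add]
            linarith
    obtain ⟨p, d, s, hw, h2, h3⟩ := key (σ.img b) x hx₀ (by
      rw [hv, map_mul]
      convert hx using 1
      ring)
    obtain ⟨a, t, ht, h4, h5⟩ := ih d (x := x - ι α ^ k * (c * ι (digit v p))) (by linarith)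
      (by linarith)
    refine ⟨a, _, ht.append (.single ⟨s, hw⟩), ?_, ?_⟩ <;>
    · rw [map_add, map_mul, map_pow]
      linarith [mul_left_comm c (ι α ^ k) (ι (digit v p))]

end Positive

/-! ### Perron–Frobenius theory through the trace form -/

section Perron

variable {A : Type*} [Fintype A] [DecidableEq A] {σ : Substitution A} {K : Type*} [Field K]
  {α : K} {v : A → K} {ι : K →+* ℝ}

theorem digit_img (hv : σ.IsLeftEigenvector α v) (b : A) :
    digit v (σ.img b) = α * v b := by
  have := congrFun hv.2 b
  simp only [Matrix.vecMul, dotProduct, Matrix.map_apply, Substitution.incidence, Matrix.of_apply,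
    Pi.smul_apply, smul_eq_mul] at this
  rw [← this, digit]
  exact Finset.sum_congr rfl fun a _ => mul_comm _ _

theorem pow_mul_eigenvector (hv : σ.IsLeftEigenvector α v) (k : ℕ) (b : A) :
    α ^ k * v b = ∑ a, ((σ.incidence ^ k) a b : K) * v a := by
  induction k generalizing b with
  | zero => simp [Matrix.one_apply]
  | succ k ih =>
    rw [pow_succ, mul_assoc, ← digit_img hv, digit, Finset.mul_sum, pow_succ]
    simp only [Matrix.mul_apply, Nat.cast_sum, Nat.cast_mul, Finset.sum_mul]
    rw [Finset.sum_comm]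
    refine Finset.sum_congr rfl fun c _ => ?_
    rw [mul_left_comm, ih, Finset.mul_sum]
    refine Finset.sum_congr rfl fun a _ => ?_
    simp only [Substitution.incidence, Matrix.of_apply]
    ring

theorem exists_walk_of_incidence_pow_pos {k : ℕ} {a b : A} (h : 0 < (σ.incidence ^ k) a b) :
    ∃ t, Walk σ α v k b a t := by
  induction k generalizing a with
  | zero =>
    by_cases hab : a = b
    · subst hab; exact ⟨0, .nil a⟩
    · simp [hab] at h
  | succ k ih =>
    rw [pow_succ', Matrix.mul_apply] at h
    obtain ⟨c, -, hc⟩ := Finset.exists_ne_zero_of_sum_ne_zero h.ne'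
    obtain ⟨t, ht⟩ := ih (Nat.pos_of_ne_zero (right_ne_zero_of_mul hc))
    have hmem : a ∈ σ.img c := by
      have := left_ne_zero_of_mul hc
      simpa [Substitution.incidence, List.count_eq_zero] using this
    obtain ⟨p, s, hs⟩ := List.append_of_mem hmem
    exact ⟨_, .cons ⟨s, hs⟩ ht⟩

variable [NumberField K]

theorem minpoly_eq_charpoly (hσ : σ.IsIrreduciblePisot (ι α)) :
    minpoly ℚ α = (σ.incidence.map (Nat.cast : ℕ → ℚ)).charpoly := by
  refine (minpoly.eq_of_irreducible_of_monic hσ.1 ?_ (Matrix.charpoly_monic _)).symm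
  have h := hσ.2.1.1
  have h2 := Polynomial.aeval_algHom_apply (ι.toRatAlgHom) α
    (σ.incidence.map (Nat.cast : ℕ → ℚ)).charpoly
  exact ι.injective (by rw [map_zero]; exact h2.symm.trans h)

theorem finrank_eq_card (hα : IntermediateField.adjoin ℚ {α} = ⊤)
    (hσ : σ.IsIrreduciblePisot (ι α)) : Module.finrank ℚ K = Fintype.card A := by
  rw [← (Field.primitive_element_iff_minpoly_natDegree_eq ℚ α).1 hα, minpoly_eq_charpoly hσ,
    Matrix.charpoly_natDegree_eq_dim]

theorem algebraAdjoin_eq_top (hα : IntermediateField.adjoin ℚ {α} = ⊤) :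
    Algebra.adjoin ℚ {α} = ⊤ := by
  rw [← IntermediateField.adjoin_simple_toSubalgebra_of_isAlgebraic
    (Algebra.IsAlgebraic.isAlgebraic α), hα, IntermediateField.top_toSubalgebra]

/-- The entries of the eigenvector span `K`, because their span is stable under `α`. -/
theorem span_range_eq_top (hα : IntermediateField.adjoin ℚ {α} = ⊤)
    (hv : σ.IsLeftEigenvector α v) : Submodule.span ℚ (Set.range v) = ⊤ := by
  set W := Submodule.span ℚ (Set.range v)
  have hstable : ∀ w ∈ W, α * w ∈ W := by
    intro w hw
    induction hw using Submodule.span_induction with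
    | mem x hx =>
      obtain ⟨b, rfl⟩ := hx
      rw [← digit_img hv, digit]
      refine Submodule.sum_mem _ fun a _ => ?_
      rw [← nsmul_eq_mul]
      exact Submodule.smul_of_tower_mem _ _ (Submodule.subset_span ⟨a, rfl⟩)
    | zero => simp
    | add x y _ _ hx hy => rw [mul_add]; exact add_mem hx hy
    | smul q x _ hx => rw [mul_smul_comm]; exact Submodule.smul_mem _ _ hx
  have hall : ∀ x : K, ∀ w ∈ W, x * w ∈ W := by
    intro x
    have hx : x ∈ Algebra.adjoin ℚ {α} := algebraAdjoin_eq_top hα ▸ Algebra.mem_top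
    induction hx using Algebra.adjoin_induction with
    | mem x hx => rw [Set.mem_singleton_iff.1 hx]; exact hstable
    | algebraMap r => intro w hw; rw [← Algebra.smul_def]; exact Submodule.smul_mem _ _ hw
    | add x y _ _ hx hy => intro w hw; rw [add_mul]; exact add_mem (hx w hw) (hy w hw)
    | mul x y _ _ hx hy => intro w hw; rw [mul_assoc]; exact hx _ (hy w hw)
  obtain ⟨a, ha⟩ := Function.ne_iff.1 hv.1
  rw [Pi.zero_apply] at ha
  refine eq_top_iff.2 fun y _ => ?_
  have := hall (y / v a) (v a) (Submodule.subset_span ⟨a, rfl⟩)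
  rwa [div_mul_cancel₀ _ ha] at this

theorem linearIndependent_eigenvector (hα : IntermediateField.adjoin ℚ {α} = ⊤)
    (hσ : σ.IsIrreduciblePisot (ι α)) (hv : σ.IsLeftEigenvector α v) :
    LinearIndependent ℚ v :=
  linearIndependent_of_top_le_span_of_card_eq_finrank (span_range_eq_top hα hv).ge
    (finrank_eq_card hα hσ).symm

/-- Every embedding of `K` other than the given real one maps `α` into the open unit disc. -/
theorem norm_embedding_lt_one (hα : IntermediateField.adjoin ℚ {α} = ⊤)
    (hσ : σ.IsIrreduciblePisot (ι α)) (τ : K →+* ℂ) (hτ : τ ≠ Complex.ofRealHom.comp ι) :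
    ‖τ α‖ < 1 := by
  refine hσ.2.2.2.2 _ ?_ ?_
  · have h1 : minpoly ℚ (ι α) = minpoly ℚ α :=
      minpoly.algHom_eq ι.toRatAlgHom ι.injective α
    rw [h1]
    have h2 := Polynomial.aeval_algHom_apply τ.toRatAlgHom α (minpoly ℚ α)
    rw [minpoly.aeval, map_zero] at h2
    exact h2
  · intro h
    apply hτ
    have h3 : τ.toRatAlgHom = (Complex.ofRealHom.comp ι).toRatAlgHom := by
      refine AlgHom.ext_of_adjoin_eq_top (algebraAdjoin_eq_top hα) ?_
      rintro _ rfl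
      exact h
    exact congrArg (fun f : K →ₐ[ℚ] ℂ => (f : K →+* ℂ)) h3

/-- The entry `(a, b)` of the powers of the incidence matrix is `Tr(w a * α ^ k * v b)`, where `w`
is the basis of `K` that is dual to `v` for the trace form. As `α` dominates its conjugates, it
grows like `α ^ k` times the product of `w a` and `v b`. -/
theorem exists_tendsto_incidence_pow (hα : IntermediateField.adjoin ℚ {α} = ⊤)
    (hσ : σ.IsIrreduciblePisot (ι α)) (hv : σ.IsLeftEigenvector α v) :
    ∃ w : A → K, (∀ a, w a ≠ 0) ∧ ∀ a b,
      Tendsto (fun k => ((σ.incidence ^ k) a b : ℝ) / ι α ^ k) atTop (𝓝 (ι (w a * v b))) := by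
  classical
  let bas : Module.Basis A ℚ K := Module.Basis.mk (linearIndependent_eigenvector hα hσ hv)
    (span_range_eq_top hα hv).ge
  have hbas : ∀ a, bas a = v a := fun a => Module.Basis.mk_apply _ _ a
  have hB := traceForm_nondegenerate ℚ K
  let w := (Algebra.traceForm ℚ K).dualBasis hB bas
  refine ⟨w, fun a => w.ne_zero a, fun a b => ?_⟩
  have hα0 : 0 < ι α := one_pos.trans hσ.2.2.2.1
  have htr : ∀ k, ((σ.incidence ^ k) a b : ℚ) = Algebra.trace ℚ K (w a * (α ^ k * v b)) := by
    intro k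
    rw [← Algebra.traceForm_apply, pow_mul_eigenvector hv, map_sum]
    have : ∀ c, Algebra.traceForm ℚ K (w a) (((σ.incidence ^ k) c b : K) * v c) =
        if c = a then ((σ.incidence ^ k) c b : ℚ) else 0 := by
      intro c
      rw [← nsmul_eq_mul, map_nsmul, ← hbas, LinearMap.BilinForm.apply_dualBasis_left]
      simp
    simp [this]
  have hsum : ∀ k, (((σ.incidence ^ k) a b : ℝ) : ℂ) / (ι α : ℂ) ^ k =
      ∑ τ : K →ₐ[ℚ] ℂ, τ (w a * v b) * (τ α / ι α) ^ k := by
    intro k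
    have h := congrArg (fun x : ℚ => (x : ℂ)) (htr k)
    have h2 := trace_eq_sum_embeddings (K := ℚ) (L := K) ℂ (x := w a * (α ^ k * v b))
    have h3 : (((σ.incidence ^ k) a b : ℝ) : ℂ) = ∑ τ : K →ₐ[ℚ] ℂ, τ (w a * (α ^ k * v b)) := by
      rw [← h2]
      simpa using h
    rw [h3, Finset.sum_div]
    refine Finset.sum_congr rfl fun τ _ => ?_
    simp only [map_mul, map_pow, div_pow]
    ring
  let τ₀ : K →ₐ[ℚ] ℂ := (Complex.ofRealHom.comp ι).toRatAlgHom
  have hlim : Tendsto (fun k => ∑ τ : K →ₐ[ℚ] ℂ, τ (w a * v b) * (τ α / ι α) ^ k) atTop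
      (𝓝 (∑ τ : K →ₐ[ℚ] ℂ, if τ = τ₀ then τ (w a * v b) else 0)) := by
    refine tendsto_finsetSum _ fun τ _ => ?_
    split_ifs with h
    · subst h
      have : τ₀ α / ι α = 1 := by
        have h1 : τ₀ α = ι α := rfl
        rw [h1, div_self]
        exact_mod_cast hα0.ne'
      simp [this]
    · have hlt : ‖τ α / ι α‖ < 1 := by
        rw [norm_div, Complex.norm_real, Real.norm_eq_abs, abs_of_pos hα0, div_lt_one hα0]
        refine (norm_embedding_lt_one hα hσ (τ : K →+* ℂ) ?_).trans hσ.2.2.2.1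
        intro h'
        exact h (AlgHom.coe_ringHom_injective h')
      simpa using (tendsto_pow_atTop_nhds_zero_of_norm_lt_one hlt).const_mul (τ (w a * v b))
  rw [Finset.sum_ite_eq' Finset.univ τ₀, if_pos (Finset.mem_univ _)] at hlim
  have hτ₀ : τ₀ (w a * v b) = ((ι (w a * v b) : ℝ) : ℂ) := rfl
  rw [hτ₀] at hlim
  rw [← Filter.tendsto_ofReal_iff]
  refine hlim.congr fun k => ?_
  rw [← hsum]
  push_cast
  rfl

theorem ne_zero_of_isLeftEigenvector (hα : IntermediateField.adjoin ℚ {α} = ⊤)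
    (hσ : σ.IsIrreduciblePisot (ι α)) (hv : σ.IsLeftEigenvector α v) (a : A) : v a ≠ 0 :=
  (linearIndependent_eigenvector hα hσ hv).ne_zero a

/-- The Perron–Frobenius properties: the incidence matrix is primitive, and the entries of the
eigenvector have the same sign. -/
theorem perron_frobenius [Nonempty A] (hα : IntermediateField.adjoin ℚ {α} = ⊤)
    (hσ : σ.IsIrreduciblePisot (ι α)) (hv : σ.IsLeftEigenvector α v) :
    (∃ c : ℝ, ∀ b, 0 < c * ι (v b)) ∧ ∀ a b, ∃ k t, Walk σ α v k b a t := by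
  obtain ⟨w, hw, hlim⟩ := exists_tendsto_incidence_pow hα hσ hv
  have hα0 : 0 < ι α := one_pos.trans hσ.2.2.2.1
  have hpos : ∀ a b, 0 < ι (w a * v b) := by
    intro a b
    refine lt_of_le_of_ne (ge_of_tendsto' (hlim a b) fun k => by positivity) ?_
    exact ((map_ne_zero ι).2 (mul_ne_zero (hw a) (ne_zero_of_isLeftEigenvector hα hσ hv b))).symm
  obtain ⟨a₀⟩ := ‹Nonempty A›
  refine ⟨⟨ι (w a₀), fun b => by rw [← map_mul]; exact hpos a₀ b⟩, fun a b => ?_⟩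
  obtain ⟨k, hk⟩ := ((hlim a b).eventually (lt_mem_nhds (hpos a b))).exists
  refine ⟨k, exists_walk_of_incidence_pow_pos ?_⟩
  rw [lt_div_iff₀ (by positivity), zero_mul] at hk
  exact_mod_cast hk

end Perron

/-! ### Contractions of a topological ring -/

section Contraction

variable {K : Type*} [Field K] {T : Type*} [CommRing T] {Φ : K →+* T} {α : K}

variable (Φ) in
/-- The affine self-map `z ↦ c z + t` of a `K`-algebra `T`, for `c` and `t` in `K`, where `K` is
mapped to `T` by `Φ`. -/
def aff (c t : K) (z : T) : T := Φ c * z + Φ t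

theorem aff_aff (c t d s : K) (z : T) : aff Φ c t (aff Φ d s z) = aff Φ (c * d) (t + c * s) z := by
  simp only [aff, map_mul, map_add]
  ring

theorem image_aff_image_aff (c t d s : K) (S : Set T) :
    aff Φ c t '' (aff Φ d s '' S) = aff Φ (c * d) (t + c * s) '' S := by
  rw [Set.image_image]
  simp only [aff_aff]

theorem aff_one_zero (z : T) : aff Φ 1 0 z = z := by simp [aff]

theorem image_aff_one_zero (S : Set T) : aff Φ 1 0 '' S = S := by
  simp [aff_one_zero]

variable [TopologicalSpace T] [IsTopologicalRing T]

theorem continuous_aff (c t : K) : Continuous (aff Φ c t) := by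
  unfold aff
  fun_prop

variable (Φ) in
/-- For `c ≠ 0` the map `z ↦ c z + t` is a homeomorphism. -/
def affHomeo (c t : K) (hc : c ≠ 0) : T ≃ₜ T where
  toFun := aff Φ c t
  invFun := aff Φ c⁻¹ (-c⁻¹ * t)
  left_inv z := by rw [aff_aff, inv_mul_cancel₀ hc]; simp [aff]
  right_inv z := by
    rw [aff_aff, mul_inv_cancel₀ hc, neg_mul, mul_neg, mul_inv_cancel_left₀ hc]
    simp [aff]
  continuous_toFun := continuous_aff _ _
  continuous_invFun := continuous_aff _ _

theorem coe_affHomeo (c t : K) (hc : c ≠ 0) : ⇑(affHomeo Φ c t hc) = aff Φ c t := rfl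

theorem isCompact_sub {s t : Set T} (hs : IsCompact s) (ht : IsCompact t) : IsCompact (s - t) := by
  rw [sub_eq_add_neg]
  exact hs.add ht.neg

/-- If the powers of `α` tend to zero, then they contract compact sets uniformly. -/
theorem eventually_pow_mul_mem (hΦ : Tendsto (fun k : ℕ => Φ α ^ k) atTop (𝓝 0)) {C : Set T}
    (hC : IsCompact C) {U : Set T} (hU : U ∈ 𝓝 (0 : T)) :
    ∀ᶠ k : ℕ in atTop, ∀ z ∈ C, Φ (α ^ k) * z ∈ U := by
  have h : ∀ᶠ x in 𝓝 (0 : T), ∀ z ∈ C, x * z ∈ U := by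
    refine hC.eventually_forall_of_forall_eventually fun z _ => ?_
    have hcont : Tendsto (fun q : T × T => q.1 * q.2) (𝓝 (0, z)) (𝓝 0) := by
      simpa using (continuous_mul.tendsto ((0 : T), z))
    exact hcont.eventually hU
  simpa using hΦ.eventually h

theorem tendsto_pow_mul (hΦ : Tendsto (fun k : ℕ => Φ α ^ k) atTop (𝓝 0)) {C : Set T}
    (hC : IsCompact C) {z : ℕ → T} (hz : ∀ k, z k ∈ C) :
    Tendsto (fun k => Φ (α ^ k) * z k) atTop (𝓝 0) := by
  intro U hU
  exact (eventually_pow_mul_mem hΦ hC hU).mono fun k hk => hk _ (hz k)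

end Contraction

/-! ### The subtiles as solutions of the graph-directed system -/

section Tiles

variable {A : Type*} [Fintype A] [DecidableEq A] {σ : Substitution A} {K : Type*} [Field K]
  {α : K} {v : A → K}
  {T : Type*} [CommRing T] {Φ : K →+* T}

variable (σ) in
/-- The positions in the images of the letters. They are the edges of the prefix automaton. -/
abbrev Substitution.Position : Type _ := Σ b : A, Fin (σ.img b).length

/-- The label of an edge: the prefix before the position. -/
def Substitution.Position.label (x : σ.Position) : List A := (σ.img x.1).take x.2

/-- The terminal vertex of an edge: the letter at the position. -/
def Substitution.Position.letter (x : σ.Position) : A := (σ.img x.1).get x.2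

omit [Fintype A] [DecidableEq A] in
theorem Substitution.Position.edge (x : σ.Position) : σ.Edge x.1 x.label x.letter :=
  Substitution.edge_iff_exists_fin.2 ⟨x.2, rfl, rfl⟩

omit [Fintype A] [DecidableEq A] in
theorem Substitution.Edge.exists_position {b a : A} {p : List A} (h : σ.Edge b p a) :
    ∃ x : σ.Position, x.1 = b ∧ x.label = p ∧ x.letter = a := by
  obtain ⟨i, rfl, rfl⟩ := Substitution.edge_iff_exists_fin.1 h
  exact ⟨⟨b, i⟩, rfl, rfl, rfl⟩

variable (α v Φ) in
/-- The set `α S b + Φ (δ p)` for an edge from `b` with label `p`. -/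
def edgePiece (S : A → Set T) (x : σ.Position) : Set T := aff Φ α (digit v x.label) '' S x.1

variable (σ Φ α v) in
/-- The graph-directed set equation, with the edges as positions in the images of the letters. -/
def IsSolution (S : A → Set T) : Prop :=
  ∀ a, S a = ⋃ x ∈ {x : σ.Position | x.letter = a}, edgePiece α v Φ S x

theorem isSolution_iff {S : A → Set T} : IsSolution σ α v Φ S ↔
    ∀ a, S a = ⋃ (b : A) (p : List A) (_ : σ.Edge b p a), aff Φ α (digit v p) '' S b := by
  refine forall_congr' fun a => ?_
  have : ⋃ x ∈ {x : σ.Position | x.letter = a}, edgePiece α v Φ S x =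
      ⋃ (b : A) (p : List A) (_ : σ.Edge b p a), aff Φ α (digit v p) '' S b := by
    ext z
    simp only [Set.mem_iUnion, Set.mem_ofPred_eq, exists_prop]
    constructor
    · rintro ⟨x, rfl, hz⟩
      exact ⟨x.1, x.label, x.edge, hz⟩
    · rintro ⟨b, p, he, hz⟩
      obtain ⟨x, rfl, rfl, rfl⟩ := he.exists_position
      exact ⟨x, rfl, hz⟩
  rw [this]

theorem IsSolution.image_subset {S : A → Set T} (hS : IsSolution σ α v Φ S) {k : ℕ} {b a : A}
    {t : K} (h : Walk σ α v k b a t) : aff Φ (α ^ k) t '' S b ⊆ S a := by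
  induction h with
  | nil a => simp [image_aff_one_zero]
  | @cons k b c a p t he hw ih =>
    rw [pow_succ', ← image_aff_image_aff, isSolution_iff.1 hS a]
    exact (Set.image_mono ih).trans
      (Set.subset_iUnion_of_subset c (Set.subset_iUnion_of_subset p
        (Set.subset_iUnion_of_subset he subset_rfl)))

theorem IsSolution.exists_walk {S : A → Set T} (hS : IsSolution σ α v Φ S) (k : ℕ) {a : A} {z : T}
    (hz : z ∈ S a) : ∃ b t, Walk σ α v k b a t ∧ ∃ y ∈ S b, aff Φ (α ^ k) t y = z := by
  induction k generalizing a z with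
  | zero => exact ⟨a, 0, .nil a, z, hz, by simp [aff_one_zero]⟩
  | succ k ih =>
    rw [isSolution_iff.1 hS a] at hz
    simp only [Set.mem_iUnion] at hz
    obtain ⟨c, p, he, y, hy, rfl⟩ := hz
    obtain ⟨b, t, hw, x, hx, rfl⟩ := ih hy
    exact ⟨b, _, .cons he hw, x, hx, by rw [aff_aff, pow_succ']⟩

variable [TopologicalSpace T]

variable (σ α v Φ) in
/-- The subtile, in an arbitrary topological ring that receives `K`. -/
def tile (a : A) : Set T := closure (Φ '' integerSet σ α v a)

theorem tile_nonempty (hprim : ∀ a b, ∃ k t, Walk σ α v k b a t) (a : A) :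
    (tile σ α v Φ a).Nonempty := by
  obtain ⟨k, t, h⟩ := hprim a (σ.first^[Fintype.card A] a)
  exact ⟨Φ t, subset_closure
    ⟨t, ⟨_, Substitution.iterate_first_mem_periodicPts le_rfl a, k, h⟩, rfl⟩⟩

variable [IsTopologicalRing T]

/-- Every point of a solution has arbitrarily small pieces in its neighbourhoods. -/
theorem IsSolution.exists_piece_subset (hΦ : Tendsto (fun k : ℕ => Φ α ^ k) atTop (𝓝 0))
    {S : A → Set T} (hS : IsSolution σ α v Φ S) (hc : ∀ a, IsCompact (S a)) {a : A} {z : T}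
    (hz : z ∈ S a) {U : Set T} (hU : U ∈ 𝓝 z) :
    ∃ k b t, Walk σ α v k b a t ∧ aff Φ (α ^ k) t '' S b ⊆ U := by
  have hC : IsCompact (⋃ b, S b) := isCompact_iUnion hc
  have hU' : (fun y => y + z) ⁻¹' U ∈ 𝓝 (0 : T) :=
    (continuous_add_const z).continuousAt.preimage_mem_nhds (by simpa using hU)
  obtain ⟨k, hk⟩ := (eventually_pow_mul_mem hΦ (isCompact_sub hC hC) hU').exists
  obtain ⟨b, t, hw, y, hy, rfl⟩ := hS.exists_walk k hz
  refine ⟨k, b, t, hw, ?_⟩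
  rintro _ ⟨x, hx, rfl⟩
  have := hk (x - y) (Set.sub_mem_sub (Set.mem_iUnion_of_mem b hx) (Set.mem_iUnion_of_mem b hy))
  rw [Set.mem_preimage] at this
  convert this using 1
  simp only [aff]
  ring

/-- Expanding a point of `S a` along walks of growing length and replacing the remaining points of
`S` by points of `S'` gives points of `S' a` that converge to it. -/
theorem IsSolution.subset_of_isCompact (hΦ : Tendsto (fun k : ℕ => Φ α ^ k) atTop (𝓝 0))
    [T2Space T] {S S' : A → Set T} (hS : IsSolution σ α v Φ S) (hS' : IsSolution σ α v Φ S')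
    (hc : ∀ a, IsCompact (S a)) (hc' : ∀ a, IsCompact (S' a)) (hne : ∀ a, (S' a).Nonempty) (a : A) :
    S a ⊆ S' a := by
  intro z hz
  choose b t hw y hy hyz using fun k => hS.exists_walk k hz
  choose x hx using fun k => hne (b k)
  have hC : IsCompact (⋃ b, S b) := isCompact_iUnion hc
  have hC' : IsCompact (⋃ b, S' b) := isCompact_iUnion hc'
  have h := tendsto_pow_mul hΦ (isCompact_sub hC' hC) (z := fun k => x k - y k) fun k =>
    Set.sub_mem_sub (Set.mem_iUnion_of_mem _ (hx k)) (Set.mem_iUnion_of_mem _ (hy k))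
  refine (hc' a).isClosed.mem_of_tendsto (f := fun k => aff Φ (α ^ k) (t k) (x k)) (b := atTop) ?_
    (Eventually.of_forall fun k => hS'.image_subset (hw k) ⟨_, hx k, rfl⟩)
  have h2 := h.add_const z
  rw [zero_add] at h2
  refine h2.congr fun k => ?_
  rw [← hyz k]
  simp only [aff]
  ring

/-- A contracting graph-directed system has at most one solution in non-empty compact sets. -/
theorem IsSolution.eq_of_isCompact (hΦ : Tendsto (fun k : ℕ => Φ α ^ k) atTop (𝓝 0))
    [T2Space T] {S S' : A → Set T} (hS : IsSolution σ α v Φ S) (hS' : IsSolution σ α v Φ S')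
    (hc : ∀ a, IsCompact (S a)) (hc' : ∀ a, IsCompact (S' a)) (hne : ∀ a, (S a).Nonempty)
    (hne' : ∀ a, (S' a).Nonempty) : S = S' :=
  funext fun a => (hS.subset_of_isCompact hΦ hS' hc hc' hne' a).antisymm
    (hS'.subset_of_isCompact hΦ hS hc' hc hne a)

variable (σ α v) in
/-- The images of the sums of all walks lie in a common compact set, because multiplication by `α`
is a contraction. -/
theorem exists_isCompact_walk [LocallyCompactSpace T] (hα : α ≠ 0)
    (hΦ : Tendsto (fun k : ℕ => Φ α ^ k) atTop (𝓝 0)) :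
    ∃ C : Set T, IsCompact C ∧ ∀ k b a t, Walk σ α v k b a t → Φ t ∈ C := by
  obtain ⟨V, hVc, hV⟩ := exists_compact_mem_nhds (0 : T)
  obtain ⟨W, hW, hW0, hWV⟩ := exists_open_nhds_zero_add_subset hV
  have hWn : W ∈ 𝓝 (0 : T) := hW.mem_nhds hW0
  -- sums over walks of length divisible by `m` stay in the compact set `α ^ (-j) V`
  obtain ⟨m, hm, hm0⟩ :=
    ((eventually_pow_mul_mem hΦ hVc hWn).and (eventually_gt_atTop 0)).exists
  have hF : (Φ '' {t | ∃ b a, Walk σ α v m b a t}).Finite := (finite_walkSums σ α v m).image _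
  obtain ⟨j, hj⟩ := (eventually_pow_mul_mem hΦ hF.isCompact hWn).exists
  have hj0 : α ^ j ≠ 0 := pow_ne_zero _ hα
  set V' : Set T := (affHomeo Φ (α ^ j) 0 hj0) ⁻¹' V
  have hV'c : IsCompact V' := (affHomeo Φ (α ^ j) 0 hj0).isCompact_preimage.2 hVc
  have hV' : ∀ z, z ∈ V' ↔ Φ (α ^ j) * z ∈ V := by
    intro z
    simp [V', coe_affHomeo, aff]
  have hblock : ∀ q b a t, Walk σ α v (q * m) b a t → Φ t ∈ V' := by
    intro q
    induction q with
    | zero =>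
      intro b a t h
      rw [zero_mul] at h
      rw [(Walk.zero_iff.1 h).2, hV', map_zero, mul_zero]
      exact mem_of_mem_nhds hV
    | succ q ih =>
      intro b a t h
      rw [add_mul, one_mul, add_comm] at h
      obtain ⟨c, s, r, h₁, h₂, rfl⟩ := h.split
      rw [hV']
      have h3 := hm _ ((hV' _).1 (ih _ _ _ h₂))
      have h4 := hj _ ⟨s, ⟨c, a, h₁⟩, rfl⟩
      have := hWV (Set.add_mem_add h4 h3)
      convert this using 1
      simp only [map_add, map_mul, map_pow]
      ring
  refine ⟨⋃ r ∈ Set.Iio m, ⋃ s ∈ {t | ∃ b a, Walk σ α v r b a t}, aff Φ (α ^ r) s '' V',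
    (Set.finite_Iio m).isCompact_biUnion fun r _ =>
      (finite_walkSums σ α v r).isCompact_biUnion fun s _ =>
        hV'c.image (continuous_aff _ _), ?_⟩
  intro k b a t h
  rw [← Nat.mod_add_div' k m] at h
  obtain ⟨c, s, r, h₁, h₂, rfl⟩ := h.split
  refine Set.mem_biUnion (Nat.mod_lt k hm0) (Set.mem_biUnion (x := s) ⟨c, a, h₁⟩ ?_)
  refine ⟨Φ r, hblock _ _ _ _ h₂, ?_⟩
  simp only [aff, map_add, map_mul]
  ring

theorem isCompact_tile [T2Space T] [LocallyCompactSpace T] (hα : α ≠ 0)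
    (hΦ : Tendsto (fun k : ℕ => Φ α ^ k) atTop (𝓝 0)) (a : A) : IsCompact (tile σ α v Φ a) := by
  obtain ⟨C, hC, h⟩ := exists_isCompact_walk σ α v hα hΦ
  refine hC.of_isClosed_subset isClosed_closure (closure_minimal ?_ hC.isClosed)
  rintro _ ⟨t, ⟨e, -, k, hw⟩, rfl⟩
  exact h _ _ _ _ hw

theorem isSolution_tile [T2Space T] [LocallyCompactSpace T] (hα : α ≠ 0)
    (hΦ : Tendsto (fun k : ℕ => Φ α ^ k) atTop (𝓝 0)) : IsSolution σ α v Φ (tile σ α v Φ) := by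
  intro a
  have himage : ∀ b p, Φ '' ((fun t => digit v p + α * t) '' integerSet σ α v b) =
      aff Φ α (digit v p) '' (Φ '' integerSet σ α v b) := by
    intro b p
    simp only [Set.image_image, aff, map_add, map_mul, add_comm]
  apply Set.Subset.antisymm
  · refine closure_minimal ?_ ((Set.toFinite _).isClosed_biUnion fun x _ =>
      ((isCompact_tile hα hΦ x.1).image (continuous_aff _ _)).isClosed)
    rw [integerSet_eq_iUnion]
    simp only [Set.image_iUnion, himage]
    refine Set.iUnion_subset fun b => Set.iUnion_subset fun p => Set.iUnion_subset fun he => ?_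
    obtain ⟨x, rfl, rfl, rfl⟩ := he.exists_position
    exact (Set.image_mono subset_closure).trans
      (Set.subset_biUnion_of_mem (s := {y : σ.Position | y.letter = x.letter})
        (u := edgePiece α v Φ (tile σ α v Φ)) rfl)
  · refine Set.iUnion₂_subset fun x hx => ?_
    refine (image_closure_subset_closure_image (continuous_aff _ _)).trans (closure_mono ?_)
    rw [← himage, integerSet_eq_iUnion a]
    refine Set.image_mono (Set.subset_iUnion_of_subset x.1 (Set.subset_iUnion_of_subset x.label
      (Set.subset_iUnion_of_subset ?_ subset_rfl)))
    exact (show x.letter = a from hx) ▸ x.edge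

end Tiles

/-! ### The lattice spanned by the eigenvector -/

section Lattice

variable {A : Type*} [Fintype A] [DecidableEq A] {σ : Substitution A} {K : Type*} [Field K]
  {α : K} {v : A → K}

variable (v) in
/-- The additive group generated by the entries of the eigenvector. -/
abbrev lattice : Submodule ℤ K := Submodule.span ℤ (Set.range v)

theorem digit_mem_lattice (p : List A) : digit v p ∈ lattice v := by
  induction p with
  | nil => simp
  | cons a p ih =>
    rw [digit_cons]
    exact add_mem (Submodule.subset_span ⟨a, rfl⟩) ih

theorem mul_mem_lattice (hv : ∀ b, digit v (σ.img b) = α * v b) {x : K} (hx : x ∈ lattice v) :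
    α * x ∈ lattice v := by
  induction hx using Submodule.span_induction with
  | mem x hx =>
    obtain ⟨b, rfl⟩ := hx
    rw [← hv]
    exact digit_mem_lattice _
  | zero => simp
  | add x y _ _ hx hy => rw [mul_add]; exact add_mem hx hy
  | smul q x _ hx => rw [mul_smul_comm]; exact Submodule.smul_mem _ _ hx

theorem pow_mul_mem_lattice (hv : ∀ b, digit v (σ.img b) = α * v b) (k : ℕ) {x : K}
    (hx : x ∈ lattice v) : α ^ k * x ∈ lattice v := by
  induction k with
  | zero => simpa using hx
  | succ k ih => rw [pow_succ', mul_assoc]; exact mul_mem_lattice hv ih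

theorem Walk.mem_lattice (hv : ∀ b, digit v (σ.img b) = α * v b) {k : ℕ} {b a : A} {t : K}
    (h : Walk σ α v k b a t) : t ∈ lattice v := by
  induction h with
  | nil a => simp
  | cons he hw ih => exact add_mem (digit_mem_lattice _) (mul_mem_lattice hv ih)

end Lattice

/-! ### Interior points of the subtiles -/

section Interior

theorem exists_interior_nonempty_of_biUnion {X I : Type*} [TopologicalSpace X] {s : Set I}
    (hs : s.Finite) {f : I → Set X} (hf : ∀ i ∈ s, IsClosed (f i))
    (h : (interior (⋃ i ∈ s, f i)).Nonempty) : ∃ i ∈ s, (interior (f i)).Nonempty := by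
  induction s, hs using Set.Finite.induction_on with
  | empty => simp at h
  | @insert i s _ hs ih =>
    by_cases hi : (interior (f i)).Nonempty
    · exact ⟨i, Set.mem_insert _ _, hi⟩
    · rw [Set.biUnion_insert, Set.union_comm, interior_union_isClosed_of_interior_empty
        (hs.isClosed_biUnion fun j hj => hf j (Set.mem_insert_of_mem _ hj))
        (Set.not_nonempty_iff_eq_empty.1 hi)] at h
      obtain ⟨j, hj, hj'⟩ := ih (fun j hj => hf j (Set.mem_insert_of_mem _ hj)) h
      exact ⟨j, Set.mem_insert_of_mem _ hj, hj'⟩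

variable {A : Type*} [Fintype A] [DecidableEq A] {σ : Substitution A} {K : Type*} [Field K]
  {α : K} {v : A → K} {ι : K →+* ℝ} {c : ℝ}
  {T : Type*} [CommRing T] [TopologicalSpace T] [IsTopologicalRing T] {Φ : K →+* T}

/-- The lattice points with non-negative image in the real line have the same closure as the whole
lattice, because adding a high power of `α` makes a point positive and moves it little. -/
theorem closure_image_nonneg [Nonempty A] (hv : ∀ b, digit v (σ.img b) = α * v b)
    (hc : ∀ a, 0 < c * ι (v a)) (hα : 1 < ι α)
    (hΦ : Tendsto (fun k : ℕ => Φ α ^ k) atTop (𝓝 0)) :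
    Φ '' (lattice v : Set K) ⊆ closure (Φ '' {x : K | x ∈ lattice v ∧ 0 ≤ c * ι x}) := by
  rintro _ ⟨x, hx, rfl⟩
  obtain ⟨b⟩ := ‹Nonempty A›
  refine mem_closure_of_tendsto (f := fun k : ℕ => Φ (x + α ^ k * v b)) (b := atTop) ?_ ?_
  · have := (hΦ.mul_const (Φ (v b))).const_add (Φ x)
    simpa using this
  · have h1 : Tendsto (fun k : ℕ => ι α ^ k * (c * ι (v b))) atTop atTop :=
      (tendsto_pow_atTop_atTop_of_one_lt hα).atTop_mul_const (hc b)
    filter_upwards [h1.eventually_ge_atTop (-(c * ι x))] with k hk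
    refine ⟨_, ⟨add_mem hx (pow_mul_mem_lattice hv k (Submodule.subset_span ⟨b, rfl⟩)), ?_⟩, rfl⟩
    rw [map_add, map_mul, map_pow]
    linarith [mul_left_comm c (ι α ^ k) (ι (v b))]

/-- If the lattice is dense in some open set, then some subtile has an interior point: the
non-negative lattice points of a compact set are covered by finitely many translates of subtiles. -/
theorem exists_interior_tile_nonempty [T2Space T] [LocallyCompactSpace T] [Nonempty A]
    (hv : ∀ b, digit v (σ.img b) = α * v b) (hc : ∀ a, 0 < c * ι (v a)) (hα : 1 < ι α)
    (hΦ : Tendsto (fun k : ℕ => Φ α ^ k) atTop (𝓝 0))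
    (hfin : ∀ C : Set T, IsCompact C → ∀ r : ℝ,
      {x : K | x ∈ lattice v ∧ |ι x| ≤ r ∧ Φ x ∈ C}.Finite)
    (hdense : (interior (closure (Φ '' (lattice v : Set K)))).Nonempty) :
    ∃ a, (interior (tile σ α v Φ a)).Nonempty := by
  have hα0 : α ≠ 0 := by rintro rfl; simp at hα; linarith
  obtain ⟨C, hC, hCw⟩ := exists_isCompact_walk σ α v hα0 hΦ
  obtain ⟨z₀, hz₀⟩ := hdense
  obtain ⟨B, hBc, hB⟩ := exists_compact_mem_nhds z₀
  obtain ⟨a₁, ha₁⟩ := Finite.exists_max fun a => c * ι (v a)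
  have hcne : c ≠ 0 := by rintro rfl; simpa using hc a₁
  set O := interior (closure (Φ '' (lattice v : Set K))) ∩ interior B
  have hO : IsOpen O := isOpen_interior.inter isOpen_interior
  have hOne : z₀ ∈ O := ⟨hz₀, mem_interior_iff_mem_nhds.2 hB⟩
  set P : Set K := {x | x ∈ lattice v ∧ 0 ≤ c * ι x}
  have hOP : O ⊆ closure (O ∩ Φ '' P) := by
    refine (Set.subset_inter subset_rfl ?_).trans hO.inter_closure
    exact Set.inter_subset_left.trans (interior_subset.trans
      (closure_minimal (closure_image_nonneg hv hc hα hΦ) isClosed_closure))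
  set Γ : Set K := {x : K | x ∈ lattice v ∧ |ι x| ≤ |c|⁻¹ * (c * ι (v a₁)) ∧ Φ x ∈ B - C}
  have hΓ : Γ.Finite := hfin _ (isCompact_sub hBc hC) _
  have hcover : O ∩ Φ '' P ⊆
      ⋃ q ∈ Γ ×ˢ (Set.univ : Set A), aff Φ 1 q.1 '' tile σ α v Φ q.2 := by
    rintro _ ⟨⟨-, hxB⟩, x, ⟨hx, hx0⟩, rfl⟩
    set e := σ.first^[Fintype.card A] a₁
    have he : e ∈ Function.periodicPts σ.first :=
      Substitution.iterate_first_mem_periodicPts le_rfl a₁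
    obtain ⟨k, hk⟩ := pow_unbounded_of_one_lt (c * ι x / (c * ι (v e))) hα
    rw [div_lt_iff₀ (hc e)] at hk
    obtain ⟨a, t, hw, h1, h2⟩ := exists_walk_greedy hv k e hx0 hk
    -- the lattice point `x` is the sum `t` of a walk plus one of finitely many lattice points
    refine Set.mem_biUnion (x := (x - t, a)) ⟨⟨sub_mem hx (hw.mem_lattice hv), ?_, ?_⟩, trivial⟩ ?_
    · rw [le_inv_mul_iff₀ (abs_pos.2 hcne), ← abs_mul, map_sub, mul_sub,
        abs_of_nonneg (by linarith)]
      linarith [ha₁ a]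
    · rw [map_sub]
      exact Set.sub_mem_sub (interior_subset hxB) (hCw _ _ _ _ hw)
    · exact ⟨Φ t, subset_closure ⟨t, ⟨e, he, k, hw⟩, rfl⟩, by simp [aff]⟩
  have hclosed : ∀ q ∈ Γ ×ˢ (Set.univ : Set A), IsClosed (aff Φ 1 q.1 '' tile σ α v Φ q.2) :=
    fun q _ => ((isCompact_tile hα0 hΦ q.2).image (continuous_aff _ _)).isClosed
  have hfin' : (Γ ×ˢ (Set.univ : Set A)).Finite := hΓ.prod Set.finite_univ
  obtain ⟨q, -, hq⟩ := exists_interior_nonempty_of_biUnion hfin' hclosed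
    ⟨z₀, (hO.subset_interior_iff.2 (hOP.trans (closure_minimal hcover
      (hfin'.isClosed_biUnion hclosed)))) hOne⟩
  refine ⟨q.2, ?_⟩
  rw [← coe_affHomeo _ _ one_ne_zero, ← Homeomorph.image_interior] at hq
  exact hq.of_image

variable [T2Space T] [LocallyCompactSpace T]

theorem interior_tile_nonempty (hα0 : α ≠ 0) (hΦ : Tendsto (fun k : ℕ => Φ α ^ k) atTop (𝓝 0))
    (hprim : ∀ a b, ∃ k t, Walk σ α v k b a t)
    (hint : ∃ a, (interior (tile σ α v Φ a)).Nonempty) (a : A) :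
    (interior (tile σ α v Φ a)).Nonempty := by
  obtain ⟨b, hb⟩ := hint
  obtain ⟨k, t, hw⟩ := hprim a b
  have h := interior_mono ((isSolution_tile hα0 hΦ).image_subset hw)
  rw [← coe_affHomeo _ _ (pow_ne_zero k hα0), ← Homeomorph.image_interior] at h
  exact (hb.image _).mono h

/-- Every neighbourhood of a point of a subtile contains a copy of a subtile that is part of the
given subtile, and the copy has interior points. -/
theorem closure_interior_tile (hα0 : α ≠ 0) (hΦ : Tendsto (fun k : ℕ => Φ α ^ k) atTop (𝓝 0))
    (hint : ∀ a, (interior (tile σ α v Φ a)).Nonempty) (a : A) :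
    closure (interior (tile σ α v Φ a)) = tile σ α v Φ a := by
  refine (closure_minimal interior_subset isClosed_closure).antisymm fun z hz => ?_
  rw [mem_closure_iff_nhds]
  intro U hU
  have hsol := isSolution_tile (σ := σ) (v := v) hα0 hΦ
  obtain ⟨k, b, t, hw, hU'⟩ := hsol.exists_piece_subset hΦ (isCompact_tile hα0 hΦ) hz hU
  have h := interior_mono (hsol.image_subset hw)
  rw [← coe_affHomeo _ _ (pow_ne_zero k hα0)] at h hU'
  rw [← Homeomorph.image_interior] at h
  obtain ⟨y, hy⟩ := hint b
  exact ⟨_, hU' ⟨y, interior_subset hy, rfl⟩, h ⟨y, hy, rfl⟩⟩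

end Interior

/-! ### The scaling factor of multiplication by `α` -/

section Scaling

variable {K : Type*} [Field K] {α : K}
  {T : Type*} [CommRing T] [TopologicalSpace T] [IsTopologicalRing T] {Φ : K →+* T}

variable (Φ) in
/-- Multiplication by a non-zero element of `K`, as an automorphism of the topological group. -/
def mulEquiv (c : K) (hc : c ≠ 0) : T ≃ₜ+ T where
  __ := affHomeo Φ c 0 hc
  map_add' x y := by
    change aff Φ c 0 (x + y) = aff Φ c 0 x + aff Φ c 0 y
    simp [aff, mul_add]

/-- Affine maps with linear part `α ^ k` multiply the Haar measure by the `k`-th power of a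
constant. The hypothesis that `s` has compact closure lets the uniqueness of Haar measure apply
without regularity assumptions. -/
theorem exists_measure_image_aff [LocallyCompactSpace T] [MeasurableSpace T] [BorelSpace T]
    (μ : Measure T) [μ.IsAddHaarMeasure] (hα : α ≠ 0) :
    ∃ l : NNReal, l ≠ 0 ∧ ∀ (k : ℕ) (t : K) (s : Set T), IsCompact (closure s) →
      μ (aff Φ (α ^ k) t '' s) = (l : ENNReal) ^ k * μ s := by
  have : (μ.map (mulEquiv Φ α⁻¹ (inv_ne_zero hα))).IsAddHaarMeasure :=
    ContinuousAddEquiv.isAddHaarMeasure_map μ _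
  set l := Measure.addHaarScalarFactor (μ.map (mulEquiv Φ α⁻¹ (inv_ne_zero hα))) μ
  have h1 : ∀ (t : K) (s : Set T), IsCompact (closure s) → μ (aff Φ α t '' s) = l * μ s := by
    intro t s hs
    have h := Measure.measure_isAddInvariant_eq_smul_of_isCompact_closure
      (μ.map (mulEquiv Φ α⁻¹ (inv_ne_zero hα))) μ hs
    replace h := (MeasurableEquiv.map_apply
      (affHomeo Φ α⁻¹ 0 (inv_ne_zero hα)).toMeasurableEquiv s).symm.trans h
    have h3 : aff Φ α t '' s = (fun z => z + Φ t) ''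
        ((affHomeo Φ α⁻¹ 0 (inv_ne_zero hα)) ⁻¹' s) := by
      rw [← Homeomorph.image_symm, Set.image_image]
      congr 1
      ext z
      change _ = aff Φ α⁻¹⁻¹ _ z + Φ t
      simp [aff]
    rw [h3, Set.image_add_right, measure_preimage_add_right]
    exact h
  refine ⟨l, (Measure.addHaarScalarFactor_pos_of_isAddHaarMeasure _ _).ne', fun k => ?_⟩
  induction k with
  | zero =>
    intro t s hs
    have : aff Φ (α ^ 0) t '' s = (fun z => z + Φ t) '' s := by
      rw [pow_zero]
      exact congrArg (· '' s) (funext fun z => by simp [aff])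
    rw [this, Set.image_add_right, measure_preimage_add_right, pow_zero, one_mul]
  | succ k ih =>
    intro t s hs
    have h2 : aff Φ (α ^ (k + 1)) t '' s = aff Φ α t '' (aff Φ (α ^ k) 0 '' s) := by
      rw [image_aff_image_aff, pow_succ', mul_zero, add_zero]
    rw [h2, h1 _ _ (?_), ih 0 s hs, pow_succ', mul_assoc]
    rw [← coe_affHomeo _ _ (pow_ne_zero k hα), ← Homeomorph.image_closure]
    exact hs.image (Homeomorph.continuous _)

end Scaling

section Packing

variable {A : Type*} [Fintype A] [DecidableEq A] {σ : Substitution A} {K : Type*} [Field K]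
  {α : K} {v : A → K} {ι : K →+* ℝ} {c : ℝ}
  {T : Type*} [CommRing T] [TopologicalSpace T] [IsTopologicalRing T] {Φ : K →+* T}

omit [Fintype A] [DecidableEq A] [IsTopologicalRing T] in
/-- In the zero ring the finiteness hypothesis would fail for the sequence `α ^ (-k) v b`. -/
theorem nontrivial_of_finite [Nonempty A] (hc : ∀ a, 0 < c * ι (v a)) (hα : 1 < ι α)
    (hfin : ∀ C : Set T, IsCompact C → ∀ r : ℝ,
      {x : K | (∃ k : ℕ, α ^ k * x ∈ lattice v) ∧ |ι x| ≤ r ∧ Φ x ∈ C}.Finite) :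
    Nontrivial T := by
  by_contra hT
  rw [not_nontrivial_iff_subsingleton] at hT
  obtain ⟨b⟩ := ‹Nonempty A›
  have hα0 : α ≠ 0 := by rintro rfl; simp at hα; linarith
  have hb : v b ≠ 0 := by intro h; simpa [h] using hc b
  have hinj : Function.Injective fun k : ℕ => (α ^ k)⁻¹ * v b := by
    intro i j hij
    have h := congrArg ι (inv_injective (mul_right_cancel₀ hb hij))
    rw [map_pow, map_pow] at h
    exact pow_right_injective₀ (by linarith) hα.ne' h
  have hfin' := hfin Set.univ (Set.toFinite _).isCompact |ι (v b)|
  refine Set.infinite_of_injective_forall_mem hinj (fun k => ?_) hfin'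
  refine ⟨⟨k, ?_⟩, ?_, Set.mem_univ _⟩
  · rw [mul_inv_cancel_left₀ (pow_ne_zero _ hα0)]
    exact Submodule.subset_span ⟨b, rfl⟩
  · rw [map_mul, abs_mul, map_inv₀, map_pow, abs_inv, abs_pow, abs_of_pos (by linarith)]
    exact mul_le_of_le_one_left (abs_nonneg _) (inv_le_one_of_one_le₀ (one_le_pow₀ hα.le))

/-- Multiplication by `α` scales the Haar measure by a factor of at most `α⁻¹`. There are of order
`α ^ k` sums of walks of length `k`; their images lie in a compact set, and by the discreteness of
the lattice they are the centres of disjoint translates of `α ^ k U` for a small open set `U`. -/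
theorem scaling_factor_le [T2Space T] [LocallyCompactSpace T] [MeasurableSpace T] [BorelSpace T]
    (μ : Measure T) [μ.IsAddHaarMeasure] [Nonempty A]
    (hv : ∀ b, digit v (σ.img b) = α * v b) (hc : ∀ a, 0 < c * ι (v a)) (hα : 1 < ι α)
    (hΦ : Tendsto (fun k : ℕ => Φ α ^ k) atTop (𝓝 0))
    (hfin : ∀ C : Set T, IsCompact C → ∀ r : ℝ,
      {x : K | (∃ k : ℕ, α ^ k * x ∈ lattice v) ∧ |ι x| ≤ r ∧ Φ x ∈ C}.Finite)
    {l : NNReal} (hl : ∀ (k : ℕ) (t : K) (s : Set T), IsCompact (closure s) →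
      μ (aff Φ (α ^ k) t '' s) = (l : ENNReal) ^ k * μ s) :
    ι α * l ≤ 1 := by
  have := nontrivial_of_finite hc hα hfin
  have hα0 : α ≠ 0 := by rintro rfl; simp at hα; linarith
  obtain ⟨C, hC, hCw⟩ := exists_isCompact_walk σ α v hα0 hΦ
  obtain ⟨V, hVc, hV⟩ := exists_compact_mem_nhds (0 : T)
  obtain ⟨b, hb⟩ := Finite.exists_max fun a => c * ι (v a)
  set d := c * ι (v b)
  have hd : 0 < d := hc b
  have hcne : c ≠ 0 := by rintro rfl; simpa using hc b
  -- a neighbourhood `U` whose differences avoid the non-zero lattice points of bounded size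
  set Q : Set K :=
    {x : K | (∃ k : ℕ, α ^ k * x ∈ lattice v) ∧ |ι x| ≤ |c|⁻¹ * d ∧ Φ x ∈ V - V}
  have hQ : Q.Finite := hfin _ (isCompact_sub hVc hVc) _
  have hW : (Φ '' (Q \ {0}))ᶜ ∈ 𝓝 (0 : T) := by
    refine (((hQ.subset Set.sdiff_subset).image Φ).isClosed.isOpen_compl).mem_nhds ?_
    rintro ⟨x, ⟨-, hx⟩, hx0⟩
    exact hx ((map_eq_zero Φ).1 hx0)
  obtain ⟨U', hU', hUW⟩ := exists_nhds_half_neg hW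
  set U := interior (U' ∩ V)
  have hUo : IsOpen U := isOpen_interior
  have hU0 : (0 : T) ∈ U := mem_interior_iff_mem_nhds.2 (inter_mem hU' hV)
  have hUV : U ⊆ V := interior_subset.trans Set.inter_subset_right
  have hUc : IsCompact (closure U) := hVc.closure_of_subset hUV
  have hμU : 0 < μ U := hUo.measure_pos μ ⟨0, hU0⟩
  have hμU' : μ U ≠ ⊤ := (hVc.measure_lt_top.trans_le' (measure_mono hUV)).ne
  have hμC : μ (C + V) ≠ ⊤ := (hC.add hVc).measure_lt_top.ne
  -- `⌊α ^ k⌋` disjoint translates of `α ^ k U` fit into the compact set `C + V`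
  have key : ∀ᶠ k : ℕ in atTop, (⌊ι α ^ k⌋₊ : ℝ) * (l : ℝ) ^ k ≤ (μ (C + V) / μ U).toReal := by
    filter_upwards [eventually_pow_mul_mem hΦ hVc hV] with k hk
    have hk0 : α ^ k ≠ 0 := pow_ne_zero _ hα0
    have hex : ∀ j : ℕ, ∃ a t, j < ⌊ι α ^ k⌋₊ →
        Walk σ α v k b a t ∧ c * ι t ≤ j * d ∧ j * d < c * ι t + c * ι (v a) := by
      intro j
      by_cases hj : j < ⌊ι α ^ k⌋₊
      · have hj' : (j : ℝ) < ι α ^ k :=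
          (Nat.lt_of_lt_floor hj)
        obtain ⟨a, t, h⟩ := exists_walk_greedy hv k b (x := j * d) (by positivity)
          (mul_lt_mul_of_pos_right hj' hd)
        exact ⟨a, t, fun _ => h⟩
      · exact ⟨b, 0, fun h => absurd h hj⟩
    -- `t j` is the sum of a walk with `c t` in the interval `(j d - d, j d]`
    choose a t ht using hex
    have hinj : ∀ i j, i < ⌊ι α ^ k⌋₊ → j < ⌊ι α ^ k⌋₊ → t i = t j → i ≤ j := by
      intro i j hi hj hij
      by_contra hlt
      have h3 := (ht i hi).2.2
      rw [hij] at h3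
      have h4 := (ht j hj).2.1
      have h5 : (j : ℝ) + 1 ≤ i := by exact_mod_cast not_le.1 hlt
      linarith [mul_le_mul_of_nonneg_right h5 hd.le, hb (a i)]
    have hdisj : ((Finset.range ⌊ι α ^ k⌋₊ : Finset ℕ) : Set ℕ).PairwiseDisjoint
        fun j => aff Φ (α ^ k) (t j) '' U := by
      intro i hi j hj hij
      rw [Finset.mem_coe, Finset.mem_range] at hi hj
      refine Set.disjoint_left.2 ?_
      rintro _ ⟨x, hx, rfl⟩ ⟨y, hy, hxy⟩
      have hti := ht i hi
      have htj := ht j hj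
      have hxy' : Φ ((α ^ k)⁻¹ * (t i - t j)) = y - x := by
        have h1 : Φ (t i - t j) = Φ (α ^ k) * (y - x) := by
          simp only [aff] at hxy
          rw [map_sub, mul_sub]
          linear_combination -hxy
        rw [map_mul, h1, ← mul_assoc, ← map_mul, inv_mul_cancel₀ hk0, map_one, one_mul]
      have hmem : (α ^ k)⁻¹ * (t i - t j) ∈ Q := by
        refine ⟨⟨k, ?_⟩, ?_, ?_⟩
        · rw [mul_inv_cancel_left₀ hk0]
          exact sub_mem (hti.1.mem_lattice hv) (htj.1.mem_lattice hv)
        · have hpos : 0 < ι α ^ k := by positivity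
          have hjk : ∀ j : ℕ, j < ⌊ι α ^ k⌋₊ → (j : ℝ) * d ≤ ι α ^ k * d := fun j hj => by
            have := (Nat.lt_of_lt_floor hj).le
            gcongr
          have h1 := hti.1.nonneg hc hα
          have h2 := htj.1.nonneg hc hα
          have h3 := hjk i hi
          have h4 := hjk j hj
          rw [le_inv_mul_iff₀ (abs_pos.2 hcne), ← abs_mul, map_mul, map_inv₀, map_pow, map_sub,
            mul_left_comm, abs_mul, abs_of_pos (inv_pos.2 hpos), inv_mul_le_iff₀ hpos, abs_le]
          constructor <;> linarith [hti.2.1, htj.2.1]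
        · rw [hxy']
          exact Set.sub_mem_sub (hUV hy) (hUV hx)
      have hzero : (α ^ k)⁻¹ * (t i - t j) = 0 := by
        by_contra hne
        exact hUW y (interior_subset hy).1 x (interior_subset hx).1
          ⟨_, ⟨hmem, hne⟩, hxy'⟩
      have hteq : t i = t j := by
        simpa [hk0, sub_eq_zero] using hzero
      exact hij ((hinj i j hi hj hteq).antisymm (hinj j i hj hi hteq.symm))
    have hsub : ⋃ j ∈ Finset.range ⌊ι α ^ k⌋₊, aff Φ (α ^ k) (t j) '' U ⊆ C + V := by
      refine Set.iUnion₂_subset fun j hj => ?_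
      rintro _ ⟨x, hx, rfl⟩
      change Φ (α ^ k) * x + Φ (t j) ∈ C + V
      rw [add_comm (Φ (α ^ k) * x)]
      exact Set.add_mem_add (hCw _ _ _ _ (ht j (Finset.mem_range.1 hj)).1) (hk x (hUV hx))
    have hmeas := measure_mono (μ := μ) hsub
    rw [measure_biUnion_finset hdisj fun j _ => ((affHomeo Φ (α ^ k) (t j) hk0).isOpenMap _
      hUo).measurableSet] at hmeas
    simp only [hl k _ U hUc, Finset.sum_const, Finset.card_range, nsmul_eq_mul] at hmeas
    rw [← mul_assoc] at hmeas
    have h2 := (ENNReal.le_div_iff_mul_le (Or.inl hμU.ne') (Or.inl hμU')).2 hmeas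
    have h3 := ENNReal.toReal_mono (ENNReal.div_ne_top hμC hμU.ne') h2
    simpa using h3
  by_contra hlt
  rw [not_le] at hlt
  have h1 := tendsto_pow_atTop_atTop_of_one_lt hlt
  obtain ⟨k, hk1, hk2, hk3⟩ := (key.and ((h1.eventually_gt_atTop
    (2 * (μ (C + V) / μ U).toReal)).and
    ((tendsto_pow_atTop_atTop_of_one_lt hα).eventually_ge_atTop 2))).exists
  have h4 := Nat.lt_floor_add_one (ι α ^ k)
  have h5 : ι α ^ k / 2 ≤ (⌊ι α ^ k⌋₊ : ℝ) := by linarith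
  have h6 := mul_le_mul_of_nonneg_right h5 (pow_nonneg l.coe_nonneg k)
  rw [mul_pow] at hk2
  linarith

end Packing

/-! ### Measure-disjointness and boundaries -/

section Measure

variable {A : Type*} [Fintype A] [DecidableEq A] {σ : Substitution A} {K : Type*} [Field K]
  {α : K} {v : A → K} {ι : K →+* ℝ} {c : ℝ}
  {T : Type*} [CommRing T] [TopologicalSpace T] [IsTopologicalRing T] {Φ : K →+* T}
  [T2Space T] [LocallyCompactSpace T] [MeasurableSpace T] {μ : Measure T}

/-- The sum of the weights of the end points of the edges that leave `b`. -/
theorem sum_weight_position (hv : ∀ b, digit v (σ.img b) = α * v b) (b : A) :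
    ∑ i : Fin (σ.img b).length, c * ι (v ((σ.img b).get i)) = ι α * (c * ι (v b)) := by
  have h := congrArg (fun x => c * ι x) (hv b)
  simp only [map_mul, digit_eq_sum_map, map_list_sum, List.map_map] at h
  rw [mul_left_comm, ← h, ← Finset.mul_sum]
  congr 1
  simpa [Function.comp_def] using Fin.sum_univ_fun_getElem (σ.img b) (fun a => ι (v a))

/-- Two different pieces of a subtile overlap in a null set: the measures of the subtiles satisfy
`μ(a) ≤ α⁻¹ ∑ μ(b)`, the sum over the edges from `b` to `a`, with a deficit if pieces overlap.
Summing with the entries of the left eigenvector as weights gives the same number on both sides. -/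
theorem measure_edgePiece_inter [BorelSpace T] [μ.IsAddHaarMeasure]
    (hv : ∀ b, digit v (σ.img b) = α * v b)
    (hc : ∀ a, 0 < c * ι (v a)) (hα : 1 < ι α) (hΦ : Tendsto (fun k : ℕ => Φ α ^ k) atTop (𝓝 0))
    {l : NNReal} (hl : ∀ (k : ℕ) (t : K) (s : Set T), IsCompact (closure s) →
      μ (aff Φ (α ^ k) t '' s) = (l : ENNReal) ^ k * μ s) (hl1 : ι α * l ≤ 1)
    {x y : σ.Position} (hxy : x ≠ y) (hlet : x.letter = y.letter) :
    μ (edgePiece α v Φ (tile σ α v Φ) x ∩ edgePiece α v Φ (tile σ α v Φ) y) = 0 := by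
  have hα0 : α ≠ 0 := by rintro rfl; simp at hα; linarith
  have hcomp := isCompact_tile (σ := σ) (v := v) hα0 hΦ
  have hsol := isSolution_tile (σ := σ) (v := v) hα0 hΦ
  set P := edgePiece α v Φ (tile σ α v Φ) (σ := σ)
  have hPc : ∀ z, IsCompact (P z) := fun z => (hcomp z.1).image (continuous_aff _ _)
  have hP : ∀ z, μ.real (P z) = l * μ.real (tile σ α v Φ z.1) := by
    intro z
    have := hl 1 (digit v z.label) (tile σ α v Φ z.1) 
      (by rw [(hcomp _).isClosed.closure_eq]; exact hcomp _)
    rw [pow_one, pow_one] at this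
    rw [Measure.real, show P z = aff Φ α (digit v z.label) '' tile σ α v Φ z.1 from rfl, this]
    simp [Measure.real]
  have hPf : ∀ z, μ (P z) ≠ ⊤ := fun z => (hPc z).measure_lt_top.ne
  set E : A → Finset σ.Position := fun a => Finset.univ.filter fun z => z.letter = a
  have hE : ∀ a, tile σ α v Φ a = ⋃ z ∈ E a, P z := by
    intro a
    rw [hsol a]
    simp [E, P]
  have hle : ∀ a, μ.real (tile σ α v Φ a) ≤ ∑ z ∈ E a, μ.real (P z) := by
    intro a
    rw [hE a]
    exact measureReal_biUnion_finset_le _ _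
  -- the inequality with the overlap of the two pieces taken into account
  have hlt : μ.real (tile σ α v Φ x.letter) + μ.real (P x ∩ P y) ≤
      ∑ z ∈ E x.letter, μ.real (P z) := by
    have hx : x ∈ E x.letter := by simp [E]
    have hy : y ∈ (E x.letter).erase x := by simp [E, hlet, hxy.symm]
    rw [← Finset.add_sum_erase _ _ hx, ← Finset.add_sum_erase _ _ hy, ← add_assoc,
      ← measureReal_union_add_inter (hPc y).isClosed.measurableSet (hPf x) (hPf y)]
    have h1 : tile σ α v Φ x.letter ⊆
        (P x ∪ P y) ∪ ⋃ z ∈ ((E x.letter).erase x).erase y, P z := by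
      rw [hE x.letter]
      refine Set.iUnion₂_subset fun z hz => ?_
      by_cases hzx : z = x
      · subst hzx; exact fun w hw => Or.inl (Or.inl hw)
      by_cases hzy : z = y
      · subst hzy; exact fun w hw => Or.inl (Or.inr hw)
      · exact fun w hw => Or.inr (Set.mem_biUnion (x := z) (by simp [hz, hzx, hzy]) hw)
    have h2 : μ.real (tile σ α v Φ x.letter) ≤ μ.real (P x ∪ P y) +
        ∑ z ∈ ((E x.letter).erase x).erase y, μ.real (P z) := by
      refine (measureReal_mono h1 ?_).trans ((measureReal_union_le _ _).trans ?_)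
      · exact (((hPc x).union (hPc y)).union ((Finset.finite_toSet _).isCompact_biUnion
          fun z _ => hPc z)).measure_lt_top.ne
      · gcongr
        exact measureReal_biUnion_finset_le _ _
    linarith
  set w : A → ℝ := fun a => c * ι (v a)
  have hsum : ∑ a, w a * ∑ z ∈ E a, μ.real (P z) =
      (ι α * l) * ∑ a, w a * μ.real (tile σ α v Φ a) := by
    calc ∑ a, w a * ∑ z ∈ E a, μ.real (P z)
        = ∑ a, ∑ z ∈ E a, w z.letter * μ.real (P z) := by
          refine Finset.sum_congr rfl fun a _ => ?_
          rw [Finset.mul_sum]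
          refine Finset.sum_congr rfl fun z hz => ?_
          rw [(Finset.mem_filter.1 hz).2]
      _ = ∑ z : σ.Position, w z.letter * μ.real (P z) :=
          Finset.sum_fiberwise _ _ _
      _ = ∑ b, ∑ i : Fin (σ.img b).length,
            w ((σ.img b).get i) * (l * μ.real (tile σ α v Φ b)) := by
          rw [Fintype.sum_sigma]
          refine Finset.sum_congr rfl fun b _ => Finset.sum_congr rfl fun i _ => ?_
          rw [hP]
          rfl
      _ = (ι α * l) * ∑ a, w a * μ.real (tile σ α v Φ a) := by
          rw [Finset.mul_sum]
          refine Finset.sum_congr rfl fun b _ => ?_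
          rw [← Finset.sum_mul, sum_weight_position hv]
          simp only [w]
          ring
  have hstrict : ∑ a, w a * μ.real (tile σ α v Φ a) + w x.letter * μ.real (P x ∩ P y) ≤
      ∑ a, w a * ∑ z ∈ E a, μ.real (P z) := by
    rw [← Finset.add_sum_erase _ _ (Finset.mem_univ x.letter),
      ← Finset.add_sum_erase Finset.univ (fun a => w a * ∑ z ∈ E a, μ.real (P z))
        (Finset.mem_univ x.letter)]
    have h1 := mul_le_mul_of_nonneg_left hlt (hc x.letter).le
    have h2 : ∑ a ∈ Finset.univ.erase x.letter, w a * μ.real (tile σ α v Φ a) ≤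
        ∑ a ∈ Finset.univ.erase x.letter, w a * ∑ z ∈ E a, μ.real (P z) :=
      Finset.sum_le_sum fun a _ => mul_le_mul_of_nonneg_left (hle a) (hc a).le
    simp only [w] at h1 h2 ⊢
    linarith
  have hS : 0 ≤ ∑ a, w a * μ.real (tile σ α v Φ a) :=
    Finset.sum_nonneg fun a _ => mul_nonneg (hc a).le measureReal_nonneg
  -- as `α l ≤ 1`, the weighted sum on the right of `hstrict` is at most the one on the left
  have hfinal : w x.letter * μ.real (P x ∩ P y) ≤ 0 := by nlinarith
  have hwx : 0 < w x.letter := hc _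
  have h0 : μ.real (P x ∩ P y) = 0 :=
    le_antisymm (by nlinarith [measureReal_nonneg (μ := μ) (s := P x ∩ P y)]) measureReal_nonneg
  exact (measureReal_eq_zero_iff (measure_ne_top_of_subset Set.inter_subset_left (hPf x))).1 h0

/-- The part of the boundary of a piece that lies in the interior of the whole subtile is covered by
the other pieces, hence it is a null set. -/
theorem measure_frontier_edgePiece (hα0 : α ≠ 0)
    (hΦ : Tendsto (fun k : ℕ => Φ α ^ k) atTop (𝓝 0))
    (hdisj : ∀ x y : σ.Position, x ≠ y → x.letter = y.letter →
      μ (edgePiece α v Φ (tile σ α v Φ) x ∩ edgePiece α v Φ (tile σ α v Φ) y) = 0)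
    (x : σ.Position) : μ (frontier (edgePiece α v Φ (tile σ α v Φ) x) ∩
      interior (tile σ α v Φ x.letter)) = 0 := by
  have hcomp := isCompact_tile (σ := σ) (v := v) hα0 hΦ
  have hsol := isSolution_tile (σ := σ) (v := v) hα0 hΦ
  set P := edgePiece α v Φ (tile σ α v Φ) (σ := σ)
  have hPc : ∀ z, IsCompact (P z) := fun z => (hcomp z.1).image (continuous_aff _ _)
  have hfin : {y : σ.Position | y ≠ x ∧ y.letter = x.letter}.Finite := Set.toFinite _
  set G := ⋃ y ∈ {y : σ.Position | y ≠ x ∧ y.letter = x.letter}, P y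
  have hG : IsClosed G := hfin.isClosed_biUnion fun y _ => (hPc y).isClosed
  have hsub : frontier (P x) ∩ interior (tile σ α v Φ x.letter) ⊆
      ⋃ y ∈ {y : σ.Position | y ≠ x ∧ y.letter = x.letter}, P x ∩ P y := by
    rintro z ⟨hz, hzi⟩
    rw [← Set.inter_iUnion₂]
    refine ⟨(hPc x).isClosed.frontier_subset hz, ?_⟩
    by_contra hzG
    rw [frontier_eq_closure_inter_closure] at hz
    obtain ⟨w, ⟨hwG, hwi⟩, hwP⟩ := mem_closure_iff.1 hz.2 (Gᶜ ∩ interior (tile σ α v Φ x.letter))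
      (hG.isOpen_compl.inter isOpen_interior) ⟨hzG, hzi⟩
    have hw := interior_subset hwi
    rw [hsol] at hw
    obtain ⟨y, hy, hwy⟩ := Set.mem_iUnion₂.1 hw
    by_cases hyx : y = x
    · subst hyx; exact hwP hwy
    · exact hwG (Set.mem_biUnion (x := y) ⟨hyx, hy⟩ hwy)
  refine measure_mono_null hsub ((measure_biUnion_null_iff hfin.countable).2 fun y hy => ?_)
  exact hdisj x y (Ne.symm hy.1) hy.2.symm

/-- The same for the pieces that belong to walks, by induction on the length of the walk. -/
theorem measure_frontier_piece (hα0 : α ≠ 0)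
    (hΦ : Tendsto (fun k : ℕ => Φ α ^ k) atTop (𝓝 0))
    {l : NNReal} (hl : ∀ (k : ℕ) (t : K) (s : Set T), IsCompact (closure s) →
      μ (aff Φ (α ^ k) t '' s) = (l : ENNReal) ^ k * μ s)
    (hdisj : ∀ x y : σ.Position, x ≠ y → x.letter = y.letter →
      μ (edgePiece α v Φ (tile σ α v Φ) x ∩ edgePiece α v Φ (tile σ α v Φ) y) = 0)
    {k : ℕ} {b a : A} {t : K} (h : Walk σ α v k b a t) :
    μ (frontier (aff Φ (α ^ k) t '' tile σ α v Φ b) ∩ interior (tile σ α v Φ a)) = 0 := by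
  have hcomp := isCompact_tile (σ := σ) (v := v) hα0 hΦ
  have hsol := isSolution_tile (σ := σ) (v := v) hα0 hΦ
  induction h with
  | nil a =>
    rw [pow_zero, image_aff_one_zero]
    have : frontier (tile σ α v Φ a) ∩ interior (tile σ α v Φ a) = ∅ := by
      rw [frontier, Set.sdiff_inter_self]
    rw [this, measure_empty]
  | @cons k b d a p t he hw ih =>
    obtain ⟨x, rfl, rfl, rfl⟩ := he.exists_position
    rw [pow_succ', ← image_aff_image_aff]
    set Q := aff Φ (α ^ k) t '' tile σ α v Φ b
    have hQ : Q ⊆ tile σ α v Φ x.1 := hsol.image_subset hw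
    have hQc : IsClosed Q := ((hcomp b).image (continuous_aff _ _)).isClosed
    rw [← coe_affHomeo _ _ hα0, ← Homeomorph.image_frontier]
    have hsub : affHomeo Φ α (digit v x.label) hα0 '' frontier Q ∩
        interior (tile σ α v Φ x.letter) ⊆
        aff Φ α (digit v x.label) '' (frontier Q ∩ interior (tile σ α v Φ x.1)) ∪
        (frontier (edgePiece α v Φ (tile σ α v Φ) x) ∩ interior (tile σ α v Φ x.letter)) := by
      rintro _ ⟨⟨z, hz, rfl⟩, hzi⟩
      by_cases hzx : z ∈ interior (tile σ α v Φ x.1)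
      · exact Or.inl ⟨z, ⟨hz, hzx⟩, rfl⟩
      · refine Or.inr ⟨?_, hzi⟩
        rw [edgePiece, ← coe_affHomeo _ _ hα0, ← Homeomorph.image_frontier]
        exact ⟨z, ⟨subset_closure (hQ (hQc.frontier_subset hz)), hzx⟩, rfl⟩
    refine measure_mono_null hsub (measure_union_null ?_
      (measure_frontier_edgePiece hα0 hΦ hdisj x))
    have hl' := hl 1 (digit v x.label) (frontier Q ∩ interior (tile σ α v Φ x.1))
      ((hcomp x.1).closure_of_subset (Set.inter_subset_right.trans interior_subset))
    rw [pow_one] at hl'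
    rw [hl', ih, mul_zero]

/-- The boundary of a subtile is a null set, because some copy of the subtile is a piece in its own
interior. -/
theorem measure_frontier_tile (hα0 : α ≠ 0)
    (hΦ : Tendsto (fun k : ℕ => Φ α ^ k) atTop (𝓝 0))
    (hprim : ∀ a b, ∃ k t, Walk σ α v k b a t)
    (hint : ∀ a, (interior (tile σ α v Φ a)).Nonempty)
    {l : NNReal} (hl0 : l ≠ 0) (hl : ∀ (k : ℕ) (t : K) (s : Set T), IsCompact (closure s) →
      μ (aff Φ (α ^ k) t '' s) = (l : ENNReal) ^ k * μ s)
    (hdisj : ∀ x y : σ.Position, x ≠ y → x.letter = y.letter →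
      μ (edgePiece α v Φ (tile σ α v Φ) x ∩ edgePiece α v Φ (tile σ α v Φ) y) = 0) (a : A) :
    μ (frontier (tile σ α v Φ a)) = 0 := by
  have hcomp := isCompact_tile (σ := σ) (v := v) hα0 hΦ
  have hsol := isSolution_tile (σ := σ) (v := v) hα0 hΦ
  obtain ⟨z, hz⟩ := hint a
  obtain ⟨j, b, t, hw, hsub⟩ := hsol.exists_piece_subset hΦ hcomp (interior_subset hz)
    (isOpen_interior.mem_nhds hz)
  obtain ⟨k, s, hw'⟩ := hprim b a
  have hw2 := hw.append hw'
  have hsub2 : aff Φ (α ^ (j + k)) (t + α ^ j * s) '' tile σ α v Φ a ⊆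
      interior (tile σ α v Φ a) := by
    rw [pow_add, ← image_aff_image_aff]
    exact (Set.image_mono (hsol.image_subset hw')).trans hsub
  have hnull := measure_frontier_piece hα0 hΦ hl hdisj hw2
  have hclosed : IsClosed (aff Φ (α ^ (j + k)) (t + α ^ j * s) '' tile σ α v Φ a) :=
    ((hcomp a).image (continuous_aff _ _)).isClosed
  rw [Set.inter_eq_left.2 (hclosed.frontier_subset.trans hsub2),
    ← coe_affHomeo _ _ (pow_ne_zero _ hα0), ← Homeomorph.image_frontier, coe_affHomeo,
    hl _ _ _ ((hcomp a).closure_of_subset (hcomp a).isClosed.frontier_subset)] at hnull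
  exact (mul_eq_zero.1 hnull).resolve_left (pow_ne_zero _ (by exact_mod_cast hl0))

end Measure

/-! ### Completions at the finite places -/

section FinitePlace

variable {K : Type*} [Field K] [NumberField K] (𝔭 : HeightOneSpectrum (𝓞 K))

open NumberField.HeightOneSpectrum HeightOneSpectrum

theorem norm_algebraMap_adicCompletion (x : K) :
    ‖algebraMap K (𝔭.adicCompletion K) x‖ = NumberField.HeightOneSpectrum.adicAbv K 𝔭 x :=
  FinitePlace.norm_embedding 𝔭 x

theorem adicAbv_le_one_iff (x : K) :
    NumberField.HeightOneSpectrum.adicAbv K 𝔭 x ≤ 1 ↔ 𝔭.valuation K x ≤ 1 := by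
  rw [NumberField.HeightOneSpectrum.adicAbv_def, ← NNReal.coe_one, NNReal.coe_le_coe,
    WithZeroMulInt.toNNReal_le_one_iff (one_lt_absNorm_nnreal 𝔭)]

theorem adicAbv_lt_one_iff (x : K) :
    NumberField.HeightOneSpectrum.adicAbv K 𝔭 x < 1 ↔ 𝔭.valuation K x < 1 := by
  rw [NumberField.HeightOneSpectrum.adicAbv_def, ← NNReal.coe_one, NNReal.coe_lt_coe,
    WithZeroMulInt.toNNReal_lt_one_iff (one_lt_absNorm_nnreal 𝔭)]

theorem adicAbv_le_of_valuation_le {x : K} {n : ℕ}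
    (h : 𝔭.valuation K x ≤ WithZero.exp (-(n : ℤ))) :
    NumberField.HeightOneSpectrum.adicAbv K 𝔭 x ≤ (1 / 2) ^ n := by
  have h1 := (WithZeroMulInt.toNNReal_strictMono (one_lt_absNorm_nnreal 𝔭)).monotone h
  have h2 : (2 : ℝ) ≤ (Ideal.absNorm 𝔭.asIdeal : ℝ) := by exact_mod_cast one_lt_absNorm 𝔭
  have h3 : WithZeroMulInt.toNNReal (absNorm_ne_zero 𝔭) (WithZero.exp (-(n : ℤ))) =
      (Ideal.absNorm 𝔭.asIdeal : NNReal) ^ (-(n : ℤ)) := by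
    rw [WithZeroMulInt.toNNReal_neg_apply _ (by simp)]
    rfl
  rw [h3] at h1
  rw [NumberField.HeightOneSpectrum.adicAbv_def]
  refine (NNReal.coe_le_coe.2 h1).trans ?_
  push_cast
  rw [zpow_neg, zpow_natCast, one_div, inv_pow]
  gcongr

theorem norm_sub_le_of_sub_mem_pow {x y : 𝓞 K} {n : ℕ} (h : x - y ∈ 𝔭.asIdeal ^ n) :
    ‖algebraMap K (𝔭.adicCompletion K) (x : K) - algebraMap K (𝔭.adicCompletion K) (y : K)‖
      ≤ (1 / 2) ^ n := by
  rw [← 𝔭.intValuation_le_pow_iff_mem, ← HeightOneSpectrum.valuation_of_algebraMap (K := K)] at h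
  rw [← map_sub, ← map_sub, norm_algebraMap_adicCompletion]
  exact adicAbv_le_of_valuation_le 𝔭 h

/-- The algebraic integers are dense in the unit ball of a completion at a finite place. -/
theorem exists_integer_norm_sub_lt {z : 𝔭.adicCompletion K} (hz : ‖z‖ ≤ 1) {ε : ℝ} (hε : 0 < ε) :
    ∃ a : 𝓞 K, ‖z - algebraMap K (𝔭.adicCompletion K) (a : K)‖ < ε := by
  obtain ⟨q, hq⟩ := (HeightOneSpectrum.denseRange_algebraMap K 𝔭).exists_dist_lt z
    (ε := min (ε / 2) 1) (by positivity)
  rw [dist_eq_norm, lt_min_iff] at hq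
  have hq1 : 𝔭.valuation K q ≤ 1 := by
    rw [← adicAbv_le_one_iff, ← norm_algebraMap_adicCompletion,
      Valued.toNormedField.norm_le_one_iff]
    have h1 := Valued.toNormedField.norm_le_one_iff.1 hq.2.le
    have h2 := Valued.toNormedField.norm_le_one_iff.1 hz
    have := Valuation.map_sub_le _ h2 h1
    rwa [sub_sub_cancel] at this
  obtain ⟨n, hn⟩ := exists_pow_lt_of_lt_one (half_pos hε) (one_half_lt_one (α := ℝ))
  obtain ⟨a, ha⟩ := 𝔭.exists_valuation_sub_lt_of_integer (K := K) hq1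
    (Units.mk0 (WithZero.exp (-(n : ℤ))) (by simp))
  refine ⟨a, ?_⟩
  have h3 : ‖algebraMap K (𝔭.adicCompletion K) (a : K) - algebraMap K (𝔭.adicCompletion K) q‖
      ≤ (1 / 2) ^ n := by
    rw [← map_sub, norm_algebraMap_adicCompletion]
    exact adicAbv_le_of_valuation_le 𝔭 ha.le
  rw [norm_sub_rev] at h3
  calc _ = ‖(z - algebraMap K (𝔭.adicCompletion K) q) +
        (algebraMap K (𝔭.adicCompletion K) q - algebraMap K (𝔭.adicCompletion K) (a : K))‖ := by
        rw [sub_add_sub_cancel]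
    _ ≤ _ := norm_add_le _ _
    _ < ε := by linarith [hq.1]

/-- The unit ball is covered by small balls around representatives of the finite ring of integers
modulo a power of the prime. -/
theorem isCompact_closedBall_adicCompletion :
    IsCompact (Metric.closedBall (0 : 𝔭.adicCompletion K) 1) := by
  refine TotallyBounded.isCompact_of_isClosed ?_ Metric.isClosed_closedBall
  rw [Metric.totallyBounded_iff]
  intro ε hε
  obtain ⟨n, hn⟩ := exists_pow_lt_of_lt_one (half_pos hε) (one_half_lt_one (α := ℝ))
  have : Finite (𝓞 K ⧸ 𝔭.asIdeal ^ n) :=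
    Ideal.finiteQuotientOfFreeOfNeBot _ (pow_ne_zero n 𝔭.ne_bot)
  refine ⟨Set.range fun c : 𝓞 K ⧸ 𝔭.asIdeal ^ n =>
    algebraMap K (𝔭.adicCompletion K) (Quotient.out c : 𝓞 K), Set.finite_range _, ?_⟩
  intro z hz
  obtain ⟨a, ha⟩ := exists_integer_norm_sub_lt 𝔭 (mem_closedBall_zero_iff.1 hz) (half_pos hε)
  simp only [Set.mem_iUnion, Set.mem_range, exists_prop, exists_exists_eq_and]
  refine ⟨Ideal.Quotient.mk _ a, ?_⟩
  have h1 : a - Quotient.out (Ideal.Quotient.mk (𝔭.asIdeal ^ n) a) ∈ 𝔭.asIdeal ^ n := by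
    rw [← Ideal.Quotient.eq]
    exact (Quotient.out_eq _).symm
  have h2 := norm_sub_le_of_sub_mem_pow 𝔭 h1
  rw [Metric.mem_ball, dist_eq_norm]
  calc _ = ‖(z - algebraMap K (𝔭.adicCompletion K) (a : K)) + _‖ := by
        rw [sub_add_sub_cancel]
    _ ≤ _ := norm_add_le _ _
    _ < ε := by linarith

instance : LocallyCompactSpace (𝔭.adicCompletion K) :=
  (isCompact_closedBall_adicCompletion 𝔭).locallyCompactSpace_of_mem_nhds_of_addGroup
    (Metric.closedBall_mem_nhds 0 one_pos)

/-- Simultaneous approximation by an algebraic integer at finitely many finite places: the Chinese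
remainder theorem. -/
theorem exists_integer_forall_norm_sub_lt {I : Type*} [Finite I]
    (P : I → HeightOneSpectrum (𝓞 K)) (hP : Function.Injective P)
    {z : ∀ i, (P i).adicCompletion K} (hz : ∀ i, ‖z i‖ ≤ 1) {ε : ℝ} (hε : 0 < ε) :
    ∃ a : 𝓞 K, ∀ i, ‖z i - algebraMap K ((P i).adicCompletion K) (a : K)‖ < ε := by
  have := Fintype.ofFinite I
  obtain ⟨n, hn⟩ := exists_pow_lt_of_lt_one (half_pos hε) (one_half_lt_one (α := ℝ))
  choose b hb using fun i => exists_integer_norm_sub_lt (P i) (hz i) (half_pos hε)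
  obtain ⟨a, ha⟩ := IsDedekindDomain.exists_forall_sub_mem_ideal (s := Finset.univ)
    (fun i => (P i).asIdeal) (fun _ => n) (fun i _ => (P i).prime)
    (fun i _ j _ hij h => hij (hP (HeightOneSpectrum.ext h))) (fun i => b i)
  refine ⟨a, fun i => ?_⟩
  have h2 := norm_sub_le_of_sub_mem_pow (P i) (ha i (Finset.mem_univ i))
  rw [norm_sub_rev] at h2
  calc _ = ‖(z i - algebraMap K ((P i).adicCompletion K) (b i : K)) + _‖ := by
        rw [sub_add_sub_cancel]
    _ ≤ _ := norm_add_le _ _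
    _ < ε := by linarith [hb i]

theorem finite_valuation_lt_one {x : K} (hx : x ≠ 0) :
    Finite {𝔭 : HeightOneSpectrum (𝓞 K) // 𝔭.valuation K x < 1} := by
  have h := HeightOneSpectrum.Support.finite (R := 𝓞 K) (K := K) x⁻¹
  refine (h.subset fun 𝔭 h𝔭 => ?_ : {𝔭 : HeightOneSpectrum (𝓞 K) | _}.Finite).to_subtype
  change 1 < 𝔭.valuation K x⁻¹
  rw [map_inv₀]
  exact (one_lt_inv₀ (zero_lt_iff.2 ((Valuation.ne_zero_iff _).2 hx))).2 h𝔭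

end FinitePlace

/-! ### The lattice in the representation space -/

section RepSpace

/-- A real embedding is the only embedding that defines its place. -/
theorem mk_ne_mainPlace {K : Type*} [Field K] {ι : K →+* ℝ} {τ : K →+* ℂ}
    (hτ : τ ≠ Complex.ofRealHom.comp ι) :
    InfinitePlace.mk τ ≠ mainPlace ι := by
  rw [mainPlace, Ne, InfinitePlace.mk_eq_iff, not_or]
  refine ⟨hτ, fun h => hτ ?_⟩
  rw [← star_involutive.injective.eq_iff (a := τ)]
  refine h.trans ?_
  ext x
  simp

variable {K : Type*} [Field K] [NumberField K] {ι : K →+* ℝ} {α : K}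

theorem norm_diag_fst (x : K) (w : {w : InfinitePlace K // w ≠ mainPlace ι}) :
    ‖(diag ι α x).1 w‖ = w.1 x :=
  InfinitePlace.Completion.norm_coe _ _

theorem norm_diag_snd (x : K) (𝔭 : {𝔭 : HeightOneSpectrum (𝓞 K) // 𝔭.valuation K α < 1}) :
    ‖(diag ι α x).2 𝔭‖ = NumberField.HeightOneSpectrum.adicAbv K 𝔭.1 x :=
  norm_algebraMap_adicCompletion 𝔭.1 x

theorem norm_diag_snd_le_one (x : 𝓞 K)
    (𝔭 : {𝔭 : HeightOneSpectrum (𝓞 K) // 𝔭.valuation K α < 1}) :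
    ‖(diag ι α (x : K)).2 𝔭‖ ≤ 1 := by
  rw [norm_diag_snd, adicAbv_le_one_iff]
  exact HeightOneSpectrum.valuation_le_one _ _

theorem locallyCompactSpace_repSpace (hα : α ≠ 0) : LocallyCompactSpace (RepSpace ι α) := by
  have := finite_valuation_lt_one hα
  infer_instance

/-- Multiplication by `α` is a contraction of the representation space: the archimedean factor on
which it expands is left out, and `α` has absolute value less than one at the primes that divide
it. -/
theorem tendsto_diag_pow (hpl : ∀ τ : K →+* ℂ, τ ≠ Complex.ofRealHom.comp ι → ‖τ α‖ < 1) :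
    Tendsto (fun k : ℕ => diag ι α α ^ k) atTop (𝓝 0) := by
  refine (Prod.tendsto_iff _ _).2 ⟨tendsto_pi_nhds.2 fun w => ?_, tendsto_pi_nhds.2 fun 𝔭 => ?_⟩
  · refine tendsto_pow_atTop_nhds_zero_of_norm_lt_one (x := (diag ι α α).1 w) ?_
    rw [norm_diag_fst, ← InfinitePlace.norm_embedding_eq]
    refine hpl _ fun h => w.2 ?_
    rw [← InfinitePlace.mk_embedding w.1, h]
    rfl
  · refine tendsto_pow_atTop_nhds_zero_of_norm_lt_one (x := (diag ι α α).2 𝔭) ?_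
    rw [norm_diag_snd, adicAbv_lt_one_iff]
    exact 𝔭.2

variable {A : Type*} {v : A → K}

/-- A common denominator of the lattice. -/
theorem exists_int_mul_isIntegral [Finite A] (v : A → K) :
    ∃ m : ℤ, m ≠ 0 ∧ ∀ x ∈ lattice v, IsIntegral ℤ ((m : K) * x) := by
  classical
  have := Fintype.ofFinite A
  obtain ⟨m, hm, h⟩ := exists_integral_multiples ℤ ℚ (Finset.univ.image v)
  refine ⟨m, hm, fun x hx => ?_⟩
  induction hx using Submodule.span_induction with
  | mem x hx =>
    obtain ⟨b, rfl⟩ := hx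
    simpa [zsmul_eq_mul] using h (v b) (by simp)
  | zero => simpa using isIntegral_zero
  | add x y _ _ hx hy => rw [mul_add]; exact hx.add hy
  | smul q x _ hx => rw [mul_smul_comm]; exact hx.smul q

/-- Discreteness: in a compact part of `ℝ × RepSpace ι α` there are only finitely many elements of
the `ℤ[α⁻¹]`-module generated by the lattice. After multiplication by a power of `α` and an integer
they are algebraic integers with bounded conjugates. -/
theorem finite_setOf_mem_isCompact [Finite A] (hα0 : α ≠ 0) (hint : IsIntegral ℤ α)
    (hΦ : Tendsto (fun k : ℕ => diag ι α α ^ k) atTop (𝓝 0)) {C : Set (RepSpace ι α)}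
    (hC : IsCompact C) (r : ℝ) :
    {x : K | (∃ k : ℕ, α ^ k * x ∈ lattice v) ∧ |ι x| ≤ r ∧ diag ι α x ∈ C}.Finite := by
  have := finite_valuation_lt_one hα0
  obtain ⟨m, hm0, hm⟩ := exists_int_mul_isIntegral v
  have hU : {z : RepSpace ι α | (∀ w, ‖z.1 w‖ ≤ 1) ∧ ∀ 𝔭, ‖z.2 𝔭‖ ≤ 1} ∈ 𝓝 0 := by
    refine Filter.inter_mem (eventually_all.2 fun w => ?_) (eventually_all.2 fun 𝔭 => ?_)
    · have : Continuous fun z : RepSpace ι α => ‖z.1 w‖ := by fun_prop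
      exact (this.tendsto 0).eventually (ge_mem_nhds (by simp))
    · have : Continuous fun z : RepSpace ι α => ‖z.2 𝔭‖ := by fun_prop
      exact (this.tendsto 0).eventually (ge_mem_nhds (by simp))
  obtain ⟨j, hj⟩ := (eventually_pow_mul_mem hΦ hC hU).exists
  have hinj : Function.Injective fun x : K => (m : K) * (α ^ j * x) := fun x y h =>
    mul_left_cancel₀ (pow_ne_zero j hα0) (mul_left_cancel₀ (Int.cast_ne_zero.2 hm0) h)
  refine ((Embeddings.finite_of_norm_le K ℂ (|(m : ℝ)| * max 1 (|ι α| ^ j * r))).preimage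
    hinj.injOn).subset ?_
  rintro x ⟨⟨k, hk⟩, hxr, hxC⟩
  obtain ⟨hinf, hfin⟩ := hj _ hxC
  rw [← map_mul] at hinf hfin
  refine ⟨?_, fun τ => ?_⟩
  · have : (m : K) * (α ^ j * x) ∈ (algebraMap (𝓞 K) K).range := by
      refine HeightOneSpectrum.mem_integers_of_valuation_le_one (R := 𝓞 K) _ _ fun 𝔭 => ?_
      by_cases h𝔭 : 𝔭.valuation K α < 1
      · have h1 := hfin ⟨𝔭, h𝔭⟩
        rw [norm_diag_snd, adicAbv_le_one_iff] at h1
        have h2 : 𝔭.valuation K (m : K) ≤ 1 := by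
          simpa using 𝔭.valuation_le_one (K := K) (m : 𝓞 K)
        rw [map_mul]
        exact mul_le_one' h2 h1
      · have h1 : 𝔭.valuation K α = 1 :=
          le_antisymm (𝔭.valuation_le_one (K := K) ⟨α, hint⟩) (not_lt.1 h𝔭)
        have h2 := 𝔭.valuation_le_one (K := K) ⟨_, hm _ hk⟩
        rw [map_mul, map_mul, map_pow, h1, one_pow, one_mul, ← map_mul]
        change 𝔭.valuation K ((m : K) * (α ^ k * x)) ≤ 1 at h2
        rwa [map_mul, map_mul, map_pow, h1, one_pow, one_mul, ← map_mul] at h2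
    obtain ⟨y, hy⟩ := this
    change IsIntegral ℤ ((m : K) * (α ^ j * x))
    rw [← hy]
    exact y.2
  · rw [map_mul, norm_mul, map_intCast, Complex.norm_intCast]
    refine mul_le_mul_of_nonneg_left ?_ (abs_nonneg _)
    by_cases hτ : τ = Complex.ofRealHom.comp ι
    · refine le_max_of_le_right ?_
      have : ‖τ (α ^ j * x)‖ = |ι α| ^ j * |ι x| := by
        subst hτ
        simp
      rw [this]
      gcongr
    · refine le_max_of_le_left ?_
      have := hinf ⟨InfinitePlace.mk τ, mk_ne_mainPlace hτ⟩
      rwa [norm_diag_fst, InfinitePlace.apply] at this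

/-- Up to a non-zero integer factor the algebraic integers belong to the lattice. -/
theorem exists_int_mul_mem_lattice (hspan : Submodule.span ℚ (Set.range v) = ⊤) :
    ∃ m : ℤ, m ≠ 0 ∧ ∀ x : 𝓞 K, (m : K) * x ∈ lattice v := by
  have h : ∀ x : K, ∃ m : ℤ, m ≠ 0 ∧ (m : K) * x ∈ lattice v := by
    intro x
    have hx : x ∈ Submodule.span ℚ (Set.range v) := hspan ▸ Submodule.mem_top
    induction hx using Submodule.span_induction with
    | mem x hx => exact ⟨1, one_ne_zero, by simpa using Submodule.subset_span hx⟩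
    | zero => exact ⟨1, one_ne_zero, by simp⟩
    | add x y _ _ hx hy =>
      obtain ⟨m, hm, hx⟩ := hx
      obtain ⟨n, hn, hy⟩ := hy
      refine ⟨m * n, mul_ne_zero hm hn, ?_⟩
      have := add_mem (Submodule.smul_mem _ n hx) (Submodule.smul_mem _ m hy)
      simp only [zsmul_eq_mul] at this
      convert this using 1
      push_cast
      ring
    | smul q x _ hx =>
      obtain ⟨m, hm, hx⟩ := hx
      refine ⟨q.den * m, mul_ne_zero (by simp) hm, ?_⟩
      have := Submodule.smul_mem _ q.num hx
      rw [zsmul_eq_mul] at this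
      convert this using 1
      have hq : (q.den : K) * q = q.num := by exact_mod_cast Rat.den_mul_eq_num q
      rw [Rat.smul_def]
      push_cast
      rw [← hq]
      ring
  choose m hm0 hm using h
  set b := RingOfIntegers.basis K
  refine ⟨∏ i, m (b i : 𝓞 K), Finset.prod_ne_zero_iff.2 fun i _ => hm0 _, fun x => ?_⟩
  have hx : x ∈ Submodule.span ℤ (Set.range b) := b.span_eq ▸ Submodule.mem_top
  induction hx using Submodule.span_induction with
  | mem x hx =>
    obtain ⟨i, rfl⟩ := hx
    rw [← Finset.prod_erase_mul _ _ (Finset.mem_univ i), Int.cast_mul, mul_assoc, ← zsmul_eq_mul]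
    exact Submodule.smul_mem _ _ (hm _)
  | zero => simp
  | add x y _ _ hx hy => simpa [mul_add] using add_mem hx hy
  | smul q x _ hx =>
    rw [show ((q • x : 𝓞 K) : K) = q • (x : K) from map_zsmul (algebraMap (𝓞 K) K) q x,
      mul_smul_comm]
    exact Submodule.smul_mem _ _ hx

/-- Every point whose finite components vanish is a limit of lattice points: the lattice is
relatively dense in the archimedean part, and multiplication by `α` is a contraction. -/
theorem mem_closure_lattice_of_snd_eq_zero {σ : Substitution A} [Fintype A] [DecidableEq A]
    (hα0 : α ≠ 0) (hv : ∀ b, digit v (σ.img b) = α * v b)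
    (hspan : Submodule.span ℚ (Set.range v) = ⊤)
    (hΦ : Tendsto (fun k : ℕ => diag ι α α ^ k) atTop (𝓝 0))
    (e : (w : {w : InfinitePlace K // w ≠ mainPlace ι}) → w.1.Completion) :
    ((e, 0) : RepSpace ι α) ∈ closure (diag ι α '' (lattice v : Set K)) := by
  classical
  have := finite_valuation_lt_one hα0
  have := Fintype.ofFinite {𝔭 : HeightOneSpectrum (𝓞 K) // 𝔭.valuation K α < 1}
  set D : ℝ := 1 + ∑ a, ‖diag ι α (v a)‖
  -- a lattice point at bounded distance from any point of the archimedean part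
  have key : ∀ e : (w : {w : InfinitePlace K // w ≠ mainPlace ι}) → w.1.Completion,
      ∃ r ∈ lattice v, ‖diag ι α r - (e, 0)‖ ≤ D := by
    intro e
    have hopen : IsOpen {f : InfiniteAdeleRing K |
        ∀ w : {w : InfinitePlace K // w ≠ mainPlace ι}, ‖f w.1 - e w‖ < 1} := by
      have : {f : InfiniteAdeleRing K |
          ∀ w : {w : InfinitePlace K // w ≠ mainPlace ι}, ‖f w.1 - e w‖ < 1} =
          ⋂ w : {w : InfinitePlace K // w ≠ mainPlace ι}, {f | ‖f w.1 - e w‖ < 1} := by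
        ext; simp
      rw [this]
      refine isOpen_iInter_of_finite fun w => ?_
      have hc : Continuous fun f : InfiniteAdeleRing K => f w.1 := continuous_apply w.1
      exact isOpen_lt (hc.sub continuous_const).norm continuous_const
    obtain ⟨q, hq⟩ := (InfiniteAdeleRing.denseRange_algebraMap K).exists_mem_open hopen
      ⟨fun w => if h : w ≠ mainPlace ι then e ⟨w, h⟩ else 0, fun w => by simp [w.2]⟩
    have hqs : q ∈ Submodule.span ℚ (Set.range v) := hspan ▸ Submodule.mem_top
    obtain ⟨t, rfl⟩ := (Submodule.mem_span_range_iff_exists_fun ℚ).1 hqs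
    refine ⟨∑ a, ⌊t a⌋ • v a, sum_mem fun a _ => Submodule.smul_mem _ _
      (Submodule.subset_span ⟨a, rfl⟩), ?_⟩
    have hD0 : 0 ≤ D := by positivity
    refine norm_prod_le_iff.2 ⟨(pi_norm_le_iff_of_nonneg hD0).2 fun w => ?_,
      (pi_norm_le_iff_of_nonneg hD0).2 fun 𝔭 => ?_⟩
    · have h1 : (diag ι α (∑ a, ⌊t a⌋ • v a)).1 w - e w =
          ((diag ι α (∑ a, t a • v a)).1 w - e w) -
            (diag ι α (∑ a, Int.fract (t a) • v a)).1 w := by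
        have : ∑ a, ⌊t a⌋ • v a = ∑ a, t a • v a - ∑ a, Int.fract (t a) • v a := by
          rw [← Finset.sum_sub_distrib]
          refine Finset.sum_congr rfl fun a _ => ?_
          rw [← sub_smul, Int.self_sub_fract, Int.cast_smul_eq_zsmul]
        rw [this, map_sub]
        exact sub_right_comm _ _ _
      change ‖(diag ι α (∑ a, ⌊t a⌋ • v a)).1 w - e w‖ ≤ D
      rw [h1]
      refine (norm_sub_le _ _).trans (add_le_add (hq w).le ?_)
      rw [map_sum, Prod.fst_sum, Finset.sum_apply]
      refine (norm_sum_le _ _).trans (Finset.sum_le_sum fun a _ => ?_)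
      have h2 : ‖(diag ι α (Int.fract (t a) • v a)).1 w‖ =
          |((Int.fract (t a) : ℚ) : ℝ)| * ‖(diag ι α (v a)).1 w‖ := by
        rw [norm_diag_fst, norm_diag_fst, Rat.smul_def, map_mul, ← InfinitePlace.norm_embedding_eq,
          map_ratCast, Complex.norm_ratCast]
      have h3 : |((Int.fract (t a) : ℚ) : ℝ)| ≤ 1 := by
        rw [abs_of_nonneg (by exact_mod_cast Int.fract_nonneg _)]
        exact_mod_cast (Int.fract_lt_one _).le
      rw [h2]
      exact (mul_le_of_le_one_left (norm_nonneg _) h3).trans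
        ((norm_le_pi_norm _ w).trans (norm_fst_le _))
    · change ‖(diag ι α (∑ a, ⌊t a⌋ • v a)).2 𝔭 - 0‖ ≤ D
      rw [sub_zero, map_sum, Prod.snd_sum, Finset.sum_apply]
      refine (norm_sum_le _ _).trans (le_add_of_nonneg_of_le zero_le_one
        (Finset.sum_le_sum fun a _ => ?_))
      have h2 : (diag ι α (⌊t a⌋ • v a)).2 𝔭 =
          (diag ι α (⌊t a⌋ : K)).2 𝔭 * (diag ι α (v a)).2 𝔭 := by
        rw [zsmul_eq_mul, map_mul]
        rfl
      have h3 : ‖(diag ι α (⌊t a⌋ : K)).2 𝔭‖ ≤ 1 := by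
        simpa using norm_diag_snd_le_one (ι := ι) (⌊t a⌋ : 𝓞 K) 𝔭
      rw [h2, norm_mul]
      exact (mul_le_of_le_one_left (norm_nonneg _) h3).trans
        ((norm_le_pi_norm _ 𝔭).trans (norm_snd_le _))
  choose r hr hrD using fun j : ℕ => key ((diag ι α α⁻¹ ^ j).1 * e)
  refine mem_closure_of_tendsto (f := fun j => diag ι α (α ^ j * r j)) (b := atTop) ?_
    (Eventually.of_forall fun j => ⟨_, pow_mul_mem_lattice hv j (hr j), rfl⟩)
  have h0 : Tendsto (fun j => diag ι α α ^ j *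
      (diag ι α (r j) - ((diag ι α α⁻¹ ^ j).1 * e, 0))) atTop (𝓝 0) := by
    refine squeeze_zero_norm (a := fun j => ‖diag ι α α ^ j‖ * D) (fun j => ?_) ?_
    · exact (norm_mul_le _ _).trans (mul_le_mul_of_nonneg_left (hrD j) (norm_nonneg _))
    · simpa using hΦ.norm.mul_const D
  have h1 := h0.add_const ((e, 0) : RepSpace ι α)
  rw [zero_add] at h1
  refine h1.congr fun j => ?_
  have h2 : (((diag ι α α⁻¹ ^ j).1 * e, 0) : RepSpace ι α) = diag ι α α⁻¹ ^ j * (e, 0) := by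
    ext <;> simp
  rw [h2, mul_sub, ← mul_assoc, ← mul_pow, ← map_mul, mul_inv_cancel₀ hα0, map_one, one_pow,
    one_mul, sub_add_cancel, map_mul, map_pow]

/-- The closure of the lattice contains all points whose finite components are smaller than those
of a suitable integer `m`: the multiples by `m` of algebraic integers approximate the finite
components, and the archimedean components can be changed freely within the closure. -/
theorem interior_closure_lattice_nonempty {σ : Substitution A} [Fintype A] [DecidableEq A]
    (hα0 : α ≠ 0) (hv : ∀ b, digit v (σ.img b) = α * v b)
    (hspan : Submodule.span ℚ (Set.range v) = ⊤)
    (hΦ : Tendsto (fun k : ℕ => diag ι α α ^ k) atTop (𝓝 0)) :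
    (interior (closure (diag ι α '' (lattice v : Set K)))).Nonempty := by
  classical
  have := finite_valuation_lt_one hα0
  have := Fintype.ofFinite {𝔭 : HeightOneSpectrum (𝓞 K) // 𝔭.valuation K α < 1}
  obtain ⟨m, hm0, hm⟩ := exists_int_mul_mem_lattice hspan
  have hmK : (m : K) ≠ 0 := Int.cast_ne_zero.2 hm0
  set L : AddSubgroup (RepSpace ι α) :=
    ((lattice v).toAddSubgroup.map (diag ι α : K →+ RepSpace ι α)).topologicalClosure
  have hL : closure (diag ι α '' (lattice v : Set K)) = (L : Set (RepSpace ι α)) := rfl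
  have hE : ∀ e, ((e, 0) : RepSpace ι α) ∈ L := fun e =>
    mem_closure_lattice_of_snd_eq_zero hα0 hv hspan hΦ e
  have hopen : IsOpen {z : RepSpace ι α | ∀ 𝔭, ‖z.2 𝔭‖ < ‖(diag ι α (m : K)).2 𝔭‖} := by
    have : {z : RepSpace ι α | ∀ 𝔭, ‖z.2 𝔭‖ < ‖(diag ι α (m : K)).2 𝔭‖} =
        ⋂ 𝔭, {z : RepSpace ι α | ‖z.2 𝔭‖ < ‖(diag ι α (m : K)).2 𝔭‖} := by
      ext; simp
    rw [this]
    refine isOpen_iInter_of_finite fun 𝔭 => ?_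
    have hc : Continuous fun z : RepSpace ι α => ‖z.2 𝔭‖ := by fun_prop
    exact isOpen_lt hc continuous_const
  have hmpos : ∀ 𝔭, 0 < ‖(diag ι α (m : K)).2 𝔭‖ := by
    intro 𝔭
    rw [norm_diag_snd]
    exact (NumberField.HeightOneSpectrum.adicAbv K 𝔭.1).pos hmK
  refine ⟨0, interior_maximal ?_ hopen fun 𝔭 => by simpa using hmpos 𝔭⟩
  rintro ⟨e, f⟩ hf
  rw [hL]
  have hF : ((0, f) : RepSpace ι α) ∈ L := by
    have hcl : closure (L : Set (RepSpace ι α)) = L :=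
      IsClosed.closure_eq (AddSubgroup.isClosed_topologicalClosure _)
    rw [← SetLike.mem_coe, ← hcl]
    refine (Metric.mem_closure_iff (α := RepSpace ι α)).2 ?_
    intro ε hε
    obtain ⟨a, ha⟩ := exists_integer_forall_norm_sub_lt
      (fun 𝔭 : {𝔭 : HeightOneSpectrum (𝓞 K) // 𝔭.valuation K α < 1} => 𝔭.1)
      Subtype.val_injective (z := fun 𝔭 => f 𝔭 / (diag ι α (m : K)).2 𝔭) (fun 𝔭 => by
        rw [norm_div]
        exact (div_le_one (hmpos 𝔭)).2 (hf 𝔭).le) hε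
    refine ⟨(0, (diag ι α ((m : K) * a)).2), ?_, ?_⟩
    · have h1 : diag ι α ((m : K) * a) ∈ L := subset_closure ⟨_, hm a, rfl⟩
      have h2 := sub_mem h1 (hE (diag ι α ((m : K) * a)).1)
      have h3 : diag ι α ((m : K) * a) - ((diag ι α ((m : K) * a)).1, 0) =
          (0, (diag ι α ((m : K) * a)).2) := by
        ext <;> simp
      rwa [h3] at h2
    · rw [dist_eq_norm, Prod.mk_sub_mk, sub_zero, Prod.norm_def, max_lt_iff]
      refine ⟨by simpa using hε, (pi_norm_lt_iff hε).2 fun 𝔭 => ?_⟩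
      have h3 : f 𝔭 - (diag ι α ((m : K) * a)).2 𝔭 = (diag ι α (m : K)).2 𝔭 *
          (f 𝔭 / (diag ι α (m : K)).2 𝔭 - (diag ι α (a : K)).2 𝔭) := by
        rw [mul_sub, mul_div_cancel₀ _ (norm_pos_iff.1 (hmpos 𝔭)), map_mul]
        rfl
      change ‖f 𝔭 - (diag ι α ((m : K) * a)).2 𝔭‖ < ε
      rw [h3, norm_mul]
      have h4 : ‖(diag ι α (m : K)).2 𝔭‖ ≤ 1 := by
        simpa using norm_diag_snd_le_one (ι := ι) (m : 𝓞 K) 𝔭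
      exact (mul_le_of_le_one_left (norm_nonneg _) h4).trans_lt (ha 𝔭)
  have := add_mem (hE e) hF
  simpa using this

end RepSpace

/-! ### The subtiles of an irreducible Pisot substitution -/

section Subtile

variable {A : Type*} [Fintype A] [DecidableEq A] {σ : Substitution A} {K : Type*} [Field K]
  {α : K} {v : A → K} {ι : K →+* ℝ} {c : ℝ}

theorem sigmaIntegers_eq [Nonempty A] (hc : ∀ a, 0 < c * ι (v a)) (hα : 1 < ι α) (a : A) :
    sigmaIntegers σ ι α v a = ι '' integerSet σ α v a :=
  (limits_approxIntegers hc hα a).1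

variable [NumberField K]

theorem subtile_eq_tile [Nonempty A] (hc : ∀ a, 0 < c * ι (v a)) (hα : 1 < ι α) :
    subtile σ ι α v = tile σ α v (diag ι α) := by
  funext a
  have : {x : K | ι x ∈ sigmaIntegers σ ι α v a} = integerSet σ α v a := by
    rw [sigmaIntegers_eq hc hα]
    exact Set.preimage_image_eq _ ι.injective
  rw [subtile, tile, this]

theorem satisfiesGIFS_iff {S : A → Set (RepSpace ι α)} :
    SatisfiesGIFS σ ι α v S ↔ IsSolution σ α v (diag ι α) S :=
  isSolution_iff.symm

theorem SatisfiesGIFS.eq_iUnion_preimageExt (hα : α ≠ 0) {S : A → Set (RepSpace ι α)}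
    (hS : SatisfiesGIFS σ ι α v S) (a : A) :
    S a = ⋃ q ∈ preimageExt σ ι α v (0, a), (fun z => diag ι α α * (z + q.1)) '' S q.2 := by
  have h : ∀ (p : List A) (z : RepSpace ι α),
      diag ι α α * (z + diag ι α α⁻¹ * (0 + diag ι α (digit v p))) =
        diag ι α α * z + diag ι α (digit v p) := by
    intro p z
    rw [zero_add, mul_add, ← mul_assoc, ← map_mul, mul_inv_cancel₀ hα, map_one, one_mul]
  rw [hS a]
  ext z
  simp only [Set.mem_iUnion, piece, preimageExt, Set.mem_ofPred_eq, exists_prop]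
  constructor
  · rintro ⟨b, p, hp, y, hy, rfl⟩
    exact ⟨(_, b), ⟨p, hp, rfl⟩, y, hy, h p y⟩
  · rintro ⟨⟨_, b⟩, ⟨p, hp, rfl⟩, y, hy, rfl⟩
    exact ⟨b, p, hp, y, hy, (h p y).symm⟩

end Subtile

end PisotSubst

end

theorem mainTheorem2 {A : Type*} [Fintype A] [DecidableEq A] (σ : PisotSubst.Substitution A)
    {K : Type*} [Field K] [NumberField K] (α : K) (hα : IntermediateField.adjoin ℚ {α} = ⊤)
    (ι : K →+* ℝ) (hσ : σ.IsIrreduciblePisot (ι α))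
    (v : A → K) (hv : σ.IsLeftEigenvector α v)
    [MeasurableSpace (PisotSubst.RepSpace ι α)] [BorelSpace (PisotSubst.RepSpace ι α)]
    (μ : Measure (PisotSubst.RepSpace ι α)) [μ.IsAddHaarMeasure] :
    -- the topological limits that define the integers exist
    (∀ a, PisotSubst.IsTopologicalLimit (PisotSubst.approxIntegers σ ι α v a)
      (PisotSubst.sigmaIntegers σ ι α v a)) ∧
    -- the subtiles are the solution of the graph-directed system in non-empty compact sets
    (∀ a, (PisotSubst.subtile σ ι α v a).Nonempty ∧ IsCompact (PisotSubst.subtile σ ι α v a)) ∧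
    (∀ a, PisotSubst.subtile σ ι α v a =
      ⋃ q ∈ PisotSubst.preimageExt σ ι α v (0, a),
        (fun z => PisotSubst.diag ι α α * (z + q.1)) '' PisotSubst.subtile σ ι α v q.2) ∧
    PisotSubst.SatisfiesGIFS σ ι α v (PisotSubst.subtile σ ι α v) ∧
    (∀ S : A → Set (PisotSubst.RepSpace ι α), (∀ a, (S a).Nonempty ∧ IsCompact (S a)) →
      PisotSubst.SatisfiesGIFS σ ι α v S → S = PisotSubst.subtile σ ι α v) ∧
    -- the union is measure disjoint
    (∀ (a b b' : A) (p p' : List A), σ.Edge b p a → σ.Edge b' p' a → (b, p) ≠ (b', p') →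
      μ (PisotSubst.piece ι α v (PisotSubst.subtile σ ι α v b) p ∩
        PisotSubst.piece ι α v (PisotSubst.subtile σ ι α v b') p') = 0) ∧
    -- each subtile is the closure of its interior
    (∀ a, closure (interior (PisotSubst.subtile σ ι α v a)) = PisotSubst.subtile σ ι α v a) ∧
    -- the boundary of each subtile has measure zero
    (∀ a, μ (frontier (PisotSubst.subtile σ ι α v a)) = 0) := by
  open PisotSubst in
  obtain ⟨a₀, -⟩ := σ.exists_growing
  have : Nonempty A := ⟨a₀⟩
  have hα1 : 1 < ι α := hσ.2.2.2.1
  have hα0 : α ≠ 0 := by rintro rfl; simp at hα1; linarith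
  have hαint : IsIntegral ℤ α := (isIntegral_algHom_iff ι.toIntAlgHom ι.injective).1 hσ.2.2.1
  obtain ⟨⟨c, hc⟩, hprim⟩ := perron_frobenius hα hσ hv
  have hdig := digit_img hv
  have hspan := span_range_eq_top hα hv
  have hΦ := tendsto_diag_pow fun τ hτ => norm_embedding_lt_one hα hσ τ hτ
  have := locallyCompactSpace_repSpace (ι := ι) hα0
  have hfin := fun (C : Set (RepSpace ι α)) (hC : IsCompact C) (r : ℝ) =>
    finite_setOf_mem_isCompact (v := v) hα0 hαint hΦ hC r
  have hint := interior_tile_nonempty hα0 hΦ hprim (exists_interior_tile_nonempty hdig hc hα1 hΦ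
    (fun C hC r => (hfin C hC r).subset fun x hx => ⟨⟨0, by simpa using hx.1⟩, hx.2⟩)
    (interior_closure_lattice_nonempty hα0 hdig hspan hΦ))
  obtain ⟨l, hl0, hl⟩ := exists_measure_image_aff (Φ := diag ι α) μ hα0
  have hl1 := scaling_factor_le μ hdig hc hα1 hΦ hfin hl
  have hdisj := fun (x y : σ.Position) (hxy : x ≠ y) (h : x.letter = y.letter) =>
    measure_edgePiece_inter (μ := μ) hdig hc hα1 hΦ hl hl1 hxy h
  have hcomp := isCompact_tile (σ := σ) (v := v) hα0 hΦ
  have hne := tile_nonempty (Φ := diag ι α) hprim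
  have hsol := isSolution_tile (σ := σ) (v := v) hα0 hΦ
  rw [subtile_eq_tile hc hα1]
  refine ⟨fun a => ?_, fun a => ⟨hne a, hcomp a⟩,
    fun a => (satisfiesGIFS_iff.2 hsol).eq_iUnion_preimageExt hα0 a, satisfiesGIFS_iff.2 hsol,
    fun S hS hS' => ?_, fun a b b' p p' hp hp' hne => ?_,
    closure_interior_tile hα0 hΦ hint, measure_frontier_tile hα0 hΦ hprim hint hl0 hl hdisj⟩
  · rw [sigmaIntegers_eq hc hα1]
    exact limits_approxIntegers hc hα1 a
  · exact (satisfiesGIFS_iff.1 hS').eq_of_isCompact hΦ hsol (fun a => (hS a).2) hcomp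
      (fun a => (hS a).1) hne
  · obtain ⟨x, rfl, rfl, hx⟩ := hp.exists_position
    obtain ⟨y, rfl, rfl, hy⟩ := hp'.exists_position
    refine hdisj x y ?_ (hx.trans hy.symm)
    rintro rfl
    exact hne rfl
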